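/- Let $\Gamma \subset \mathrm{PSL}_2(\mathbb{C}) \cong \mathrm{Isom}^+(\mathbb{H}^3)$ be a discrete torsion-free subgroup with compact quotient, and let $M = \mathbb{H}^3/\Gamma$ be the corresponding closed orientable hyperbolic 3-manifold. Let $\widetilde\Gamma \subset \mathrm{SL}_2(\mathbb{C})$ be the preimage of $\Gamma$, let $k = \mathbb{Q}(\mathrm{tr}\,\gamma : \gamma \in \widetilde\Gamma)$ be the trace field of $M$, and let $A_0(M) = \{\sum a_i \gamma_i : a_i \in k,\ \gamma_i \in \widetilde\Gamma\} \subset M_2(\mathbb{C})$ be the (non-invariant) quaternion algebra of $M$ over $k$. Let $p$ be a prime number and suppose that $A_0(M)$ ramifies at a finite prime $\mathfrak{p}$ of $k$ of norm $p^n$, i.e. $k_{\mathfrak{p}} \otimes_k A_0(M)$ is a division algebra, where $k_{\mathfrak{p}}$ is the completion of $k$ at $\mathfrak{p}$ and the residue field of $\mathfrak{p}$ has $p^n$ elements. Suppose that $\beta_1(M) = \dim H^1(M;\mathbb{Q}) = 0$, that $|H_1(M;\mathbb{Z})|$ is coprime to $p^{2n}-1$, and that $\pi_1(M)$ is $p$-powerful,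 i.e. every finite $p$-group quotient $S$ of $\pi_1(M)$ is powerful: $S/S^p$ is abelian if $p$ is odd, and $S/S^4$ is abelian if $p = 2$, where $S^m$ is the subgroup generated by all $m$-th powers. Then $M$ can be exhausted by rational homology spheres: there is a tower of finite covers $M = M_0 \leftarrow M_1 \leftarrow M_2 \leftarrow \cdots$ with $\beta_1(M_k) = 0$ for all $k$ and $\mathrm{injrad}(M_k) \to \infty$ as $k \to \infty$. Here $\mathrm{injrad}(N)$ is the supremum of the radii $r$ such that a ball of radius $r$ is embedded around every point of $N$. -/

import Mathlib

noncomputable section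

namespace HypMfd

open scoped MatrixGroups ComplexOrder NNReal ENNReal TensorProduct
open Matrix

/-! ### Hyperbolic 3-space and the action of `PSL(2, ℂ)` -/

/-- The group `SL(2, ℂ)`. -/
abbrev SL2C : Type := Matrix.SpecialLinearGroup (Fin 2) ℂ

/-- The group `PSL(2, ℂ) = SL(2, ℂ) / {± 1}`, with the quotient topology. It is the group of
orientation preserving isometries of hyperbolic 3-space. -/
abbrev PSL2C : Type := Matrix.ProjectiveSpecialLinearGroup (Fin 2) ℂ

/-- Hyperbolic 3-space `ℍ³` in the hyperboloid model. The determinant is a quadratic form of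
signature `(1, 3)` on the real vector space of Hermitian `2 × 2` matrices; `ℍ³` is the
positive sheet of `det = 1`, that is, the set of positive definite Hermitian matrices of
determinant one. It carries the subspace topology. -/
def H3 : Type := {P : Matrix (Fin 2) (Fin 2) ℂ // P.PosDef ∧ P.det = 1}

instance : TopologicalSpace H3 :=
  inferInstanceAs (TopologicalSpace {P : Matrix (Fin 2) (Fin 2) ℂ // P.PosDef ∧ P.det = 1})

/-- The hyperbolic distance (curvature `-1`): `cosh d(P, Q) = ⟨P, Q⟩`, where
`⟨P, Q⟩ = tr (P⁻¹ Q) / 2` is the polarization of `det` on matrices of determinant one. -/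
def hdist (P Q : H3) : ℝ :=
  Real.arcosh ((Matrix.trace (P.1⁻¹ * Q.1)).re / 2)

/-- `SL(2, ℂ)` acts on `ℍ³` by `g • P = g P gᴴ`. -/
instance : MulAction SL2C H3 where
  smul g P := ⟨g.1 * P.1 * g.1ᴴ,
    P.2.1.mul_mul_conjTranspose_same (by
      rw [Matrix.vecMul_injective_iff_isUnit, Matrix.isUnit_iff_isUnit_det, g.2]
      exact isUnit_one),
    by rw [Matrix.det_mul, Matrix.det_mul, Matrix.det_conjTranspose, g.2, P.2.2]; simp⟩
  one_smul P := Subtype.ext (by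
    change (1 : Matrix (Fin 2) (Fin 2) ℂ) * P.1 * (1 : Matrix (Fin 2) (Fin 2) ℂ)ᴴ = P.1
    simp)
  mul_smul g h P := Subtype.ext (by
    change (g.1 * h.1) * P.1 * (g.1 * h.1)ᴴ = g.1 * (h.1 * P.1 * h.1ᴴ) * g.1ᴴ
    simp [Matrix.conjTranspose_mul, Matrix.mul_assoc])

/-- The centre of `SL(2, ℂ)` acts trivially on `ℍ³`. -/
theorem center_le_ker :
    Subgroup.center SL2C ≤ (MulAction.toPermHom SL2C H3).ker := by
  intro g hg
  obtain ⟨r, hr, hrg⟩ := Matrix.SpecialLinearGroup.mem_center_iff.1 hg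
  have h2 : r * star r = 1 := by
    simp only [Fintype.card_fin] at hr
    rcases sq_eq_sq_iff_eq_or_eq_neg.1 (hr.trans (one_pow 2).symm) with h | h <;> simp [h]
  rw [MonoidHom.mem_ker]
  ext P
  apply Subtype.ext
  change g.1 * P.1 * g.1ᴴ = P.1
  rw [← hrg, Matrix.scalar_apply, ← Matrix.smul_one_eq_diagonal, Matrix.conjTranspose_smul,
    Matrix.conjTranspose_one]
  simp only [Matrix.smul_mul, Matrix.mul_smul, one_mul, mul_one, smul_smul]
  rw [mul_comm, h2, one_smul]

/-- The action of `PSL(2, ℂ)` on `ℍ³` induced by that of `SL(2, ℂ)`. -/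
instance : MulAction PSL2C H3 :=
  MulAction.compHom H3
    (QuotientGroup.lift (Subgroup.center SL2C) (MulAction.toPermHom SL2C H3) center_le_ker)

/-- The quotient space `ℍ³ / Γ`, with the quotient topology. -/
abbrev Mfd (Γ : Subgroup PSL2C) : Type := MulAction.orbitRel.Quotient Γ H3

/-- `ℍ³ / Γ` is a closed orientable hyperbolic 3-manifold: `Γ` is a discrete torsion-free subgroup
of `PSL(2, ℂ)` with compact quotient, that is, a torsion-free uniform lattice. -/
structure IsClosedHyperbolic (Γ : Subgroup PSL2C) : Prop where
  discrete : DiscreteTopology Γ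
  torsionFree : ∀ g ∈ Γ, IsOfFinOrder g → g = 1
  compact : CompactSpace (Mfd Γ)

/-- The injectivity radius of `ℍ³ / Γ`: the supremum of all `r` such that the ball of radius `r`
around every point is embedded, that is, every open ball of radius `r` of `ℍ³` is mapped
injectively to `ℍ³ / Γ`. -/
def injRad (Γ : Subgroup PSL2C) : ℝ≥0∞ :=
  ⨆ (r : ℝ≥0) (_ : ∀ x : H3, Set.InjOn (fun y : H3 => (Quotient.mk'' y : Mfd Γ))
    {y | hdist x y < r}), (r : ℝ≥0∞)

/-! ### Singular homology and cohomology -/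

/-- The singular `n`-simplices of `X`. -/
abbrev Simp (X : Type) [TopologicalSpace X] (n : ℕ) : Type := C(stdSimplex ℝ (Fin (n + 1)), X)

/-- The `i`-th face of a singular simplex. -/
def face {X : Type} [TopologicalSpace X] {n : ℕ} (i : Fin (n + 2)) (σ : Simp X (n + 1)) :
    Simp X n :=
  σ.comp ⟨stdSimplex.map i.succAbove, stdSimplex.continuous_map _⟩

/-- The boundary map `C_{n+1}(X; R) → C_n(X; R)` of the singular chain complex. -/
def boundary (R : Type) [CommRing R] (X : Type) [TopologicalSpace X] (n : ℕ) :
    (Simp X (n + 1) →₀ R) →ₗ[R] (Simp X n →₀ R) :=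
  Finsupp.lift _ R _ fun σ => ∑ i : Fin (n + 2), (-1 : R) ^ (i : ℕ) • Finsupp.single (face i σ) 1

/-- The coboundary map `C^n(X; R) → C^{n+1}(X; R)` of the singular cochain complex. -/
def coboundary (R : Type) [CommRing R] (X : Type) [TopologicalSpace X] (n : ℕ) :
    (Simp X n → R) →ₗ[R] (Simp X (n + 1) → R) :=
  LinearMap.pi fun σ => ∑ i : Fin (n + 2), (-1 : R) ^ (i : ℕ) • LinearMap.proj (face i σ)

/-- The first singular homology group `H_1(X; ℤ)`: cycles modulo boundaries. -/
abbrev H1 (X : Type) [TopologicalSpace X] : Type :=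
  (LinearMap.ker (boundary ℤ X 0)) ⧸
    (LinearMap.range (boundary ℤ X 1)).submoduleOf (LinearMap.ker (boundary ℤ X 0))

/-- The first singular cohomology group `H^1(X; ℚ)`: cocycles modulo coboundaries. -/
abbrev cohomH1 (X : Type) [TopologicalSpace X] : Type :=
  (LinearMap.ker (coboundary ℚ X 1)) ⧸
    (LinearMap.range (coboundary ℚ X 0)).submoduleOf (LinearMap.ker (coboundary ℚ X 1))

/-- The first Betti number `β₁(X) = dim H^1(X; ℚ)`, as a cardinal. -/
def betti1 (X : Type) [TopologicalSpace X] : Cardinal := Module.rank ℚ (cohomH1 X)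

/-! ### The quaternion algebra of a Kleinian group -/

/-- The preimage of `Γ` in `SL(2, ℂ)`. -/
def lift (Γ : Subgroup PSL2C) : Subgroup SL2C :=
  Γ.comap (QuotientGroup.mk' (Subgroup.center SL2C))

/-- The trace field `ℚ(tr Γ)`. -/
def traceField (Γ : Subgroup PSL2C) : IntermediateField ℚ ℂ :=
  IntermediateField.adjoin ℚ {t | ∃ g ∈ lift Γ, t = Matrix.trace g.1}

/-- The (non-invariant) quaternion algebra `A₀(Γ)`: the subalgebra over the trace field of the
algebra of `2 × 2` matrices that is generated by (equivalently, as `Γ` is a group, spanned by)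
the elements of `Γ`. -/
def quatAlg (Γ : Subgroup PSL2C) : Subalgebra (traceField Γ) (Matrix (Fin 2) (Fin 2) ℂ) :=
  Algebra.adjoin (traceField Γ) {m | ∃ g ∈ lift Γ, m = g.1}

/-- The completion of a field `K` at a valuation ring of `K` is a `K`-algebra through the canonical
embedding. -/
instance completionAlgebra {K : Type} [Field K] (V : ValuationSubring K) :
    Algebra K V.valuation.Completion :=
  ((algebraMap (WithVal V.valuation) V.valuation.Completion).comp
    (WithVal.equiv V.valuation).symm.toRingHom).toAlgebra

/-- The quaternion algebra `A₀(Γ)` ramifies at a prime of norm `q`. A finite prime of the trace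
field `k` is given by its discrete valuation ring `V ⊆ k` (for a number field these rings are
exactly the localizations of the ring of integers at the nonzero prime ideals, and the norm is the
cardinality of the residue field); the algebra ramifies at `V` if its base change to the completion
of `k` at `V` is a division algebra. -/
def RamifiesAtPrimeOfNorm (Γ : Subgroup PSL2C) (q : ℕ) : Prop :=
  ∃ V : ValuationSubring (traceField Γ),
    IsDiscreteValuationRing V ∧ Nat.card (IsLocalRing.ResidueField V) = q ∧
    ∀ a : V.valuation.Completion ⊗[traceField Γ] quatAlg Γ, a ≠ 0 → IsUnit a

/-! ### Powerful groups -/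

/-- A finite `p`-group `S` is powerful if `S / S^p` is abelian (`S / S^4` if `p = 2`), where `S^m`
is the subgroup generated by all `m`-th powers. -/
def IsPowerful (p : ℕ) (S : Type) [Group S] : Prop :=
  commutator S ≤ Subgroup.closure (Set.range fun s : S => s ^ (if p = 2 then 4 else p))

/-- A group is `p`-powerful if all its finite `p`-group quotients are powerful. -/
def IsPPowerful (p : ℕ) (G : Type) [Group G] : Prop :=
  ∀ (N : Subgroup G) [N.Normal], Finite (G ⧸ N) → IsPGroup p (G ⧸ N) → IsPowerful p (G ⧸ N)

/-! ### Exhaustion by rational homology spheres -/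

/-- `M = ℍ³ / Γ` can be exhausted by rational homology spheres: there is a tower
`M = M₀ ← M₁ ← M₂ ← ⋯` of finite covers `M_k = ℍ³ / Λ_k`, given by a decreasing sequence of
subgroups `Λ_k` of finite index in `Γ`, with `β₁(M_k) = 0` for all `k` and injectivity radius
tending to infinity. -/
def ExhaustedByRationalHomologySpheres (Γ : Subgroup PSL2C) : Prop :=
  ∃ Λ : ℕ → Subgroup PSL2C, Λ 0 = Γ ∧ Antitone Λ ∧ (∀ k, (Λ k).IsFiniteRelIndex Γ) ∧
    (∀ k, betti1 (Mfd (Λ k)) = 0) ∧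
    Filter.Tendsto (fun k => injRad (Λ k)) Filter.atTop (nhds ⊤)

end HypMfd

end

/-! The ramified prime supplies a tower of normal congruence subgroups with `p`-group quotients, and
`p`-powerfulness keeps the first Betti number zero along any such tower.

The tower. Write `q = p ^ n`. If an element of the quaternion algebra had nonzero trace `t` and
determinant `d` with `d / t ^ 2` in the maximal ideal, its characteristic polynomial would split
over the completion by a Hensel argument, which a division algebra forbids
(`not_valuation_det_div_trace_sq_lt_one`). Hence traces of group elements are integral at `V`, the
preimage of the group spans a finitely generated `V`-order (`matOrder_fg`), and the elements of
non-unit determinant form a two-sided ideal (`detIdeal`). The quotient is a finite domain, so a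
field, and each group element satisfies a quadratic equation over the residue field of order `q`.
Its image therefore has order dividing `q ^ 2 - 1`; commutators die in a field, so the coprimality
hypothesis forces the image to be `± 1` (`eq_one_or_eq_neg_one`). After a choice of sign every
element is congruent to `1` modulo the ideal, and `p`-th powers push it into ever deeper congruence
subgroups (`exists_congruence_tower`). These intersect trivially, so by discreteness and
cocompactness the injectivity radius tends to infinity (`tendsto_injRad`).

Betti numbers. Let `N` be normal of `p`-power index in `G`. Dividing by the common kernel of the
rational characters of `N` turns `N` into a lattice `A` (`character_eq_one_of_powerful`).
Powerfulness of the finite `p`-quotients passes to iterated `p`-power subgroups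
(`commutator_powIter_le`), so on a deep one, contained in `A`, conjugation is trivial modulo `p`, or
modulo `4` if `p = 2`. It also has `p`-power order, hence is trivial by Minkowski's argument
(`eq_one_of_congr_one`). The group is then central-by-finite, and composing the transfer with
characters of `A` gives characters of `G`. There are none, so `A` vanishes (`eq_bot_of_powerful`).

Betti numbers and characters are matched through the covering by the contractible space `H3`
(`character_eq_one_of_betti1`, `betti1_eq_zero_of_character`). -/

noncomputable section
namespace HypMfd

/-! ### Power subgroups and powerful embeddings -/

section Powerful

open Subgroup
open scoped commutatorElement

variable {G : Type*} [Group G]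

/-- The subgroup generated by the `m`-th powers of the elements of `N`. -/
def powSub (N : Subgroup G) (m : ℕ) : Subgroup G :=
  Subgroup.closure ((fun x => x ^ m) '' (N : Set G))

theorem pow_mem_powSub {N : Subgroup G} {x : G} (hx : x ∈ N) (m : ℕ) : x ^ m ∈ powSub N m :=
  Subgroup.subset_closure ⟨x, hx, rfl⟩

theorem powSub_le_iff {N K : Subgroup G} {m : ℕ} : powSub N m ≤ K ↔ ∀ x ∈ N, x ^ m ∈ K := by
  rw [powSub, Subgroup.closure_le]
  exact Set.forall_mem_image

theorem powSub_le_self (N : Subgroup G) (m : ℕ) : powSub N m ≤ N :=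
  powSub_le_iff.2 fun _ hx => N.pow_mem hx m

instance powSub_normal (N : Subgroup G) [hN : N.Normal] (m : ℕ) : (powSub N m).Normal := by
  refine ⟨fun x hx g => ?_⟩
  have : powSub N m ≤ (powSub N m).comap (MulAut.conj g).toMonoidHom := by
    refine powSub_le_iff.2 fun y hy => ?_
    rw [Subgroup.mem_comap, map_pow]
    exact pow_mem_powSub (hN.conj_mem y hy g) m
  exact this hx

theorem map_powSub {H : Type*} [Group H] (f : G →* H) (N : Subgroup G) (m : ℕ) :
    (powSub N m).map f = powSub (N.map f) m := by
  rw [powSub, MonoidHom.map_closure, powSub, Set.image_image, Subgroup.coe_map, Set.image_image]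
  simp

/-- The exponent in the definition of powerful `p`-groups. -/
def powExp (p : ℕ) : ℕ := if p = 2 then 4 else p

/-- Collection in nilpotency class two: moving `d ^ n` past one `x` costs `z ^ n`, and these costs
add up to a binomial coefficient. -/
theorem mul_pow_of_commutator_central {x d z : G} (h : d * x = x * d * z) (hx : Commute z x)
    (hd : Commute z d) (n : ℕ) : (x * d) ^ n = x ^ n * d ^ n * z ^ (n.choose 2) := by
  have key : ∀ n : ℕ, d ^ n * x = x * d ^ n * z ^ n := by
    intro n
    induction n with
    | zero => simp
    | succ n ih =>
      rw [pow_succ' d, mul_assoc, ih, ← mul_assoc, ← mul_assoc, h, pow_succ' z]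
      simp only [mul_assoc]
      rw [← mul_assoc z (d ^ n), (hd.pow_right n).eq]
      simp only [mul_assoc]
  induction n with
  | zero => simp
  | succ n ih =>
    have ech : (n + 1).choose 2 = n + n.choose 2 := by
      rw [Nat.choose_succ_succ' n 1, Nat.choose_one_right]
    rw [pow_succ, ih, ech]
    have e1 : z ^ n.choose 2 * (x * d) = x * d * z ^ n.choose 2 :=
      ((hx.mul_right hd).pow_left _).eq
    rw [mul_assoc, e1, mul_assoc (x ^ n), ← mul_assoc (d ^ n), ← mul_assoc (d ^ n), key n,
      mul_assoc x, mul_assoc x, mul_assoc (d ^ n), (hd.pow_left n).eq, pow_add z, pow_succ x n,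
      pow_succ d n]
    simp only [mul_assoc]

theorem commute_of_mem_of_commutator_eq_bot {C : Subgroup G} (h : ⁅C, (⊤ : Subgroup G)⁆ = ⊥)
    {z : G} (hz : z ∈ C) (g : G) : Commute z g := by
  have : ⁅z, g⁆ ∈ ⁅C, (⊤ : Subgroup G)⁆ := Subgroup.commutator_mem_commutator hz trivial
  rw [h, Subgroup.mem_bot] at this
  exact commutatorElement_eq_one_iff_commute.1 this

theorem commutator_eq_bot_of_commute {C : Subgroup G} (h : ∀ z ∈ C, ∀ g : G, Commute z g) :
    ⁅C, (⊤ : Subgroup G)⁆ = ⊥ := by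
  rw [eq_bot_iff, Subgroup.commutator_le]
  intro z hz g _
  exact commutatorElement_eq_one_iff_commute.2 (h z hz g)

theorem powSub_commute {N : Subgroup G} {m : ℕ} (h : ∀ x ∈ N, ∀ g : G, g * x ^ m * g⁻¹ = x ^ m) :
    ⁅powSub N m, (⊤ : Subgroup G)⁆ = ⊥ := by
  apply commutator_eq_bot_of_commute
  intro z hz g
  have : powSub N m ≤ Subgroup.centralizer {g} := by
    refine powSub_le_iff.2 fun x hx => ?_
    rw [Subgroup.mem_centralizer_singleton_iff]
    exact (mul_inv_eq_iff_eq_mul.1 (h x hx g)).symm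
  exact Subgroup.mem_centralizer_singleton_iff.1 (this hz)

theorem conj_eq_mul_commutator (x g : G) : g * x * g⁻¹ = x * ⁅x⁻¹, g⁆ := by
  simp [commutatorElement_def, mul_assoc]

theorem mul_eq_mul_commutator (d x : G) : d * x = x * d * ⁅d⁻¹, x⁻¹⁆ := by
  simp [commutatorElement_def, mul_assoc]

/-- Conjugation turns `x ^ p` into `(x * d) ^ p` with `d` in the `p`-power subgroup. Collecting
leaves `d ^ p` and a central element to the power `p.choose 2`; both vanish, since an odd `p`
divides that coefficient. -/
theorem commutator_powSub_eq_bot_odd {p : ℕ} (hp : p.Prime) (hp2 : p ≠ 2) (N : Subgroup G)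
    [N.Normal] (hN : ⁅N, (⊤ : Subgroup G)⁆ ≤ powSub N p) (h1 : powSub (powSub N p) p = ⊥)
    (h2 : ⁅⁅powSub N p, (⊤ : Subgroup G)⁆, (⊤ : Subgroup G)⁆ = ⊥) :
    ⁅powSub N p, (⊤ : Subgroup G)⁆ = ⊥ := by
  have hexp : ∀ y ∈ powSub N p, y ^ p = 1 := fun y hy => by
    have := pow_mem_powSub hy p
    rwa [h1, Subgroup.mem_bot] at this
  apply powSub_commute
  intro x hx g
  set d := ⁅x⁻¹, g⁆ with hd
  have hdM : d ∈ powSub N p :=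
    hN (Subgroup.commutator_mem_commutator (N.inv_mem hx) trivial)
  set z := ⁅d⁻¹, x⁻¹⁆ with hz
  have hzC : z ∈ ⁅powSub N p, (⊤ : Subgroup G)⁆ :=
    Subgroup.commutator_mem_commutator (inv_mem hdM) trivial
  have hzM : z ∈ powSub N p := Subgroup.commutator_le_left _ _ hzC
  have hcen := commute_of_mem_of_commutator_eq_bot h2 hzC
  rw [← conj_pow, conj_eq_mul_commutator, ← hd,
    mul_pow_of_commutator_central (mul_eq_mul_commutator d x) (hcen x) (hcen d), hexp d hdM,
    mul_one]
  have : p ∣ p.choose 2 := hp.dvd_choose_self (by norm_num) (by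
    have := hp.two_le; omega)
  obtain ⟨k, hk⟩ := this
  rw [hk, pow_mul, hexp _ hzM, one_pow, mul_one]

/-- For `p = 2` the coefficient `p.choose 2` is odd, so the argument goes through fourth powers.
Writing `x ^ 4 = (x ^ 2) ^ 2` shows that they are central; being eighth powers, their squares
vanish; then the error term `d` in `(x * d) ^ 2` is central with `d ^ 2 = 1`. -/
theorem commutator_powSub_eq_bot_two (N : Subgroup G) [N.Normal]
    (hN : ⁅N, (⊤ : Subgroup G)⁆ ≤ powSub N 4) (h1 : powSub (powSub N 2) 4 = ⊥)
    (h2 : ⁅⁅powSub N 2, (⊤ : Subgroup G)⁆, (⊤ : Subgroup G)⁆ = ⊥)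
    (h3 : powSub ⁅powSub N 2, (⊤ : Subgroup G)⁆ 2 = ⊥) :
    ⁅powSub N 2, (⊤ : Subgroup G)⁆ = ⊥ := by
  have h4 : ∀ x ∈ N, ∀ g : G, g * x ^ 4 * g⁻¹ = x ^ 4 := by
    intro x hx g
    have hm := pow_mem_powSub hx 2
    have hc : ⁅(x ^ 2)⁻¹, g⁆ ∈ ⁅powSub N 2, (⊤ : Subgroup G)⁆ :=
      Subgroup.commutator_mem_commutator (inv_mem hm) trivial
    have h5 := pow_mem_powSub hc 2
    rw [h3, Subgroup.mem_bot] at h5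
    rw [show x ^ 4 = (x ^ 2) ^ 2 by rw [← pow_mul], ← conj_pow, conj_eq_mul_commutator,
      (commute_of_mem_of_commutator_eq_bot h2 hc _).symm.mul_pow, h5, mul_one]
  have hcen := powSub_commute h4
  have hsq : ∀ d ∈ powSub N 4, d ^ 2 = 1 := by
    intro d hd
    induction hd using Subgroup.closure_induction with
    | mem y hy =>
      obtain ⟨x, hx, rfl⟩ := hy
      have := pow_mem_powSub (pow_mem_powSub hx 2) 4
      rw [h1, Subgroup.mem_bot] at this
      simp only
      rw [← this, ← pow_mul, ← pow_mul]
    | one => simp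
    | mul a b ha hb iha ihb =>
      rw [(commute_of_mem_of_commutator_eq_bot hcen ha b).mul_pow, iha, ihb, one_mul]
    | inv a _ iha => rw [inv_pow, iha, inv_one]
  apply powSub_commute
  intro x hx g
  have hd : ⁅x⁻¹, g⁆ ∈ powSub N 4 :=
    hN (Subgroup.commutator_mem_commutator (N.inv_mem hx) trivial)
  rw [← conj_pow, conj_eq_mul_commutator,
    (commute_of_mem_of_commutator_eq_bot hcen hd _).symm.mul_pow, hsq _ hd, mul_one]

/-- Removes the extra assumption `h3` of `commutator_powSub_eq_bot_two`. The commutator subgroup is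
central and generated by elements killed by `4`; being contained in its own squares, it is killed by
`2`, and then its squares are trivial. -/
theorem commutator_eq_bot_of_le_sq (M : Subgroup G) (h1 : powSub M 4 = ⊥)
    (h2 : ⁅⁅M, (⊤ : Subgroup G)⁆, (⊤ : Subgroup G)⁆ = ⊥)
    (h3 : ⁅M, (⊤ : Subgroup G)⁆ ≤ powSub ⁅M, (⊤ : Subgroup G)⁆ 2) :
    ⁅M, (⊤ : Subgroup G)⁆ = ⊥ := by
  have hc := @commute_of_mem_of_commutator_eq_bot _ _ _ h2
  have h4 : ∀ c ∈ ⁅M, (⊤ : Subgroup G)⁆, c ^ 4 = 1 := by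
    intro c hcm
    induction hcm using Subgroup.closure_induction with
    | mem y hy =>
      obtain ⟨x, hx, g, -, rfl⟩ := hy
      have hx4 : x ^ 4 = 1 := by
        have := pow_mem_powSub hx 4
        rwa [h1, Subgroup.mem_bot] at this
      have hxi : x⁻¹ ^ 4 = 1 := by rw [inv_pow, hx4, inv_one]
      have e := conj_eq_mul_commutator x⁻¹ g
      rw [inv_inv] at e
      have e4 := congrArg (· ^ 4) e
      simp only [conj_pow, hxi, mul_one, mul_inv_cancel] at e4
      rw [(hc (Subgroup.commutator_mem_commutator hx trivial) _).symm.mul_pow, hxi,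
        one_mul] at e4
      exact e4.symm
    | one => simp
    | mul a b ha hb iha ihb => rw [(hc ha b).mul_pow, iha, ihb, one_mul]
    | inv a _ iha => rw [inv_pow, iha, inv_one]
  have h5 : ∀ c ∈ powSub ⁅M, (⊤ : Subgroup G)⁆ 2, c ^ 2 = 1 := by
    intro c hcm
    induction hcm using Subgroup.closure_induction with
    | mem y hy =>
      obtain ⟨x, hx, rfl⟩ := hy
      simp only
      rw [← pow_mul, h4 x hx]
    | one => simp
    | mul a b ha hb iha ihb =>
      rw [(hc (powSub_le_self _ _ ha) b).mul_pow, iha, ihb, one_mul]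
    | inv a _ iha => rw [inv_pow, iha, inv_one]
  rw [eq_bot_iff]
  refine h3.trans (powSub_le_iff.2 fun x hx => ?_)
  rw [Subgroup.mem_bot]
  exact h5 x (h3 hx)

theorem sup_commutator_top_le (L K : Subgroup G) [L.Normal] [K.Normal] :
    ⁅L ⊔ K, (⊤ : Subgroup G)⁆ ≤ L ⊔ ⁅K, (⊤ : Subgroup G)⁆ := by
  rw [Subgroup.commutator_le]
  intro x hx g _
  obtain ⟨l, hl, k, hk, rfl⟩ := Subgroup.mem_sup_of_normal_left.1 hx
  have e : ⁅l * k, g⁆ = l * ⁅k, g⁆ * l⁻¹ * ⁅l, g⁆ := by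
    simp [commutatorElement_def, mul_assoc]
  rw [e]
  refine mul_mem (Subgroup.mem_sup_right ?_) (Subgroup.mem_sup_left ?_)
  · exact Subgroup.Normal.conj_mem (H := ⁅K, (⊤ : Subgroup G)⁆) inferInstance _
      (Subgroup.commutator_mem_commutator hk trivial) _
  · exact Subgroup.commutator_le_left L ⊤ (Subgroup.commutator_mem_commutator hl trivial)

/-- Substituting the inclusion into itself pushes the error term down the lower central series. This
is what allows one to work modulo `⁅C, ⊤⁆`. -/
theorem le_of_le_sup_commutator [Group.IsNilpotent G] {C L : Subgroup G} [L.Normal]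
    (h : C ≤ L ⊔ ⁅C, (⊤ : Subgroup G)⁆) : C ≤ L := by
  have key : ∀ n, C ≤ L ⊔ (⊤ : Subgroup G).lowerCentralSeries n := by
    intro n
    induction n with
    | zero => simp
    | succ n ih =>
      refine h.trans (sup_le le_sup_left ?_)
      exact (Subgroup.commutator_mono ih le_rfl).trans (sup_commutator_top_le _ _)
  obtain ⟨n, hn⟩ := Subgroup.nilpotent_iff_lowerCentralSeries.1 ‹Group.IsNilpotent G›
  simpa [hn] using key n

/-- Powerful embedding passes to the `p`-power subgroup. By nilpotency it suffices to argue in the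
quotient where the target and the double commutator are trivial; for `p = 2` the squares of the
commutator subgroup are first killed as well and then restored. -/
theorem commutator_powSub_le {p : ℕ} (hp : p.Prime) [Group.IsNilpotent G] (N : Subgroup G)
    [N.Normal] (hN : ⁅N, (⊤ : Subgroup G)⁆ ≤ powSub N (powExp p)) :
    ⁅powSub N p, (⊤ : Subgroup G)⁆ ≤ powSub (powSub N p) (powExp p) := by
  have htop : ∀ K : Subgroup G, ∀ [K.Normal], (⊤ : Subgroup G).map (QuotientGroup.mk' K) = ⊤ :=
    fun K _ => Subgroup.map_top_of_surjective _ (QuotientGroup.mk'_surjective K)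
  have hbot : ∀ K : Subgroup G, ∀ [K.Normal], ∀ H : Subgroup G,
      H.map (QuotientGroup.mk' K) = ⊥ ↔ H ≤ K := fun K _ H => by
    rw [Subgroup.map_eq_bot_iff, QuotientGroup.ker_mk']
  have hle : ∀ K : Subgroup G, ∀ [K.Normal],
      ⁅N.map (QuotientGroup.mk' K), (⊤ : Subgroup (G ⧸ K))⁆ ≤
        powSub (N.map (QuotientGroup.mk' K)) (powExp p) := fun K _ => by
    rw [← htop K, ← Subgroup.map_commutator, ← map_powSub]
    exact Subgroup.map_mono hN
  apply le_of_le_sup_commutator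
  by_cases hp2 : p = 2
  · subst hp2
    simp only [powExp, if_true] at *
    set M := powSub N 2 with hM
    set C := ⁅M, (⊤ : Subgroup G)⁆ with hC
    have step1 : C ≤ powSub M 4 ⊔ ⁅C, (⊤ : Subgroup G)⁆ ⊔ powSub C 2 := by
      set K := powSub M 4 ⊔ ⁅C, (⊤ : Subgroup G)⁆ ⊔ powSub C 2 with hK
      have : (N.map (QuotientGroup.mk' K)).Normal :=
        Subgroup.Normal.map inferInstance _ (QuotientGroup.mk'_surjective K)
      have := commutator_powSub_eq_bot_two (N.map (QuotientGroup.mk' K)) (hle K)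
      simp only [← map_powSub, ← htop K, ← Subgroup.map_commutator, hbot K] at this
      exact this (le_sup_left.trans le_sup_left) (le_sup_right.trans le_sup_left) le_sup_right
    set K := powSub M 4 ⊔ ⁅C, (⊤ : Subgroup G)⁆ with hK
    have h2 := commutator_eq_bot_of_le_sq (M.map (QuotientGroup.mk' K))
    simp only [← map_powSub, ← htop K, ← Subgroup.map_commutator, hbot K] at h2
    refine h2 le_sup_left le_sup_right ?_
    refine (Subgroup.map_mono step1).trans ?_
    rw [Subgroup.map_sup, (hbot K K).2 le_rfl, bot_sup_eq]
  · simp only [powExp, if_neg hp2] at *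
    set K := powSub (powSub N p) p ⊔ ⁅⁅powSub N p, (⊤ : Subgroup G)⁆, (⊤ : Subgroup G)⁆ with hK
    have : (N.map (QuotientGroup.mk' K)).Normal :=
      Subgroup.Normal.map inferInstance _ (QuotientGroup.mk'_surjective K)
    have := commutator_powSub_eq_bot_odd hp hp2 (N.map (QuotientGroup.mk' K)) (hle K)
    simp only [← map_powSub, ← htop K, ← Subgroup.map_commutator, hbot K] at this
    exact this le_sup_left le_sup_right

/-- The iterated `p`-power subgroups. -/
def powIter (G : Type*) [Group G] (p : ℕ) : ℕ → Subgroup G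
  | 0 => ⊤
  | i + 1 => powSub (powIter G p i) p

instance powIter_normal (p i : ℕ) : (powIter G p i).Normal := by
  induction i with
  | zero => rw [powIter]; infer_instance
  | succ i ih => rw [powIter]; infer_instance

theorem map_powIter {H : Type*} [Group H] (f : G →* H) (hf : Function.Surjective f) (p i : ℕ) :
    (powIter G p i).map f = powIter H p i := by
  induction i with
  | zero => exact Subgroup.map_top_of_surjective f hf
  | succ i ih => rw [powIter, map_powSub, ih, powIter]

theorem pow_mem_powIter (x : G) (p i : ℕ) : x ^ p ^ i ∈ powIter G p i := by
  induction i with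
  | zero => trivial
  | succ i ih => rw [pow_succ, pow_mul]; exact pow_mem_powSub ih p

theorem commutator_powIter_le {p : ℕ} (hp : p.Prime) [Group.IsNilpotent G]
    (h : commutator G ≤ powSub ⊤ (powExp p)) (i : ℕ) :
    ⁅powIter G p i, (⊤ : Subgroup G)⁆ ≤ powSub (powIter G p i) (powExp p) := by
  induction i with
  | zero => exact h
  | succ i ih => exact commutator_powSub_le hp _ ih

/-- If equality held, the abelianization of `H` would be `p`-divisible and of `p`-power exponent,
hence trivial; but a nontrivial `p`-group is solvable and so not perfect. -/
theorem powSub_lt {p : ℕ} (hp : p.Prime) [Finite G] (hG : IsPGroup p G) (H : Subgroup G)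
    (hH : H ≠ ⊥) : powSub H p < H := by
  refine lt_of_le_of_ne (powSub_le_self H p) fun heq => hH ?_
  have := Fact.mk hp
  have hHp : IsPGroup p H := hG.to_subgroup H
  have hnil : Group.IsNilpotent H := hHp.isNilpotent
  have htop : ∀ y : Abelianization H, ∃ x, x ^ p = y := by
    have h1 : powSub (⊤ : Subgroup H) p = ⊤ := by
      apply Subgroup.map_injective H.subtype_injective
      rw [map_powSub, ← MonoidHom.range_eq_map, Subgroup.range_subtype, heq]
    have h2 : (⊤ : Subgroup H) ≤
        ((powMonoidHom p : Abelianization H →* _).range).comap Abelianization.of := by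
      rw [← h1, powSub_le_iff]
      intro x _
      rw [Subgroup.mem_comap, map_pow]
      exact ⟨_, rfl⟩
    intro y
    obtain ⟨x, rfl⟩ := QuotientGroup.mk_surjective y
    obtain ⟨z, hz⟩ := h2 (Subgroup.mem_top x)
    exact ⟨z, hz⟩
  have hpow : ∀ n : ℕ, ∀ y : Abelianization H, ∃ x, x ^ p ^ n = y := by
    intro n
    induction n with
    | zero => exact fun y => ⟨y, by simp⟩
    | succ n ih =>
      intro y
      obtain ⟨x, rfl⟩ := htop y
      obtain ⟨z, rfl⟩ := ih x
      exact ⟨z, by rw [pow_succ, pow_mul]⟩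
  obtain ⟨n, hn⟩ := IsPGroup.iff_card.1 hHp
  have hone : ∀ y : Abelianization H, y = 1 := by
    intro y
    obtain ⟨x, rfl⟩ := hpow n y
    obtain ⟨z, rfl⟩ : ∃ z, Abelianization.of z = x := QuotientGroup.mk_surjective x
    rw [← map_pow, ← hn, pow_card_eq_one', map_one]
  have hcomm : commutator H = ⊤ := by
    rw [eq_top_iff]
    intro x _
    exact (QuotientGroup.eq_one_iff x).1 (hone (QuotientGroup.mk x))
  by_contra hne
  have : Nontrivial H := (Subgroup.nontrivial_iff_ne_bot H).2 hne
  exact (Group.IsSolvable.commutator_lt_top_of_nontrivial H).ne hcomm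

theorem exists_powIter_eq_bot {p : ℕ} (hp : p.Prime) [Finite G] (hG : IsPGroup p G) :
    ∃ i, powIter G p i = ⊥ := by
  by_contra! hne
  have : StrictAnti (powIter G p) :=
    strictAnti_nat_of_succ_lt fun i => powSub_lt hp hG _ (hne i)
  exact not_injective_infinite_finite _ this.injective

end Powerful
end HypMfd
end

noncomputable section
namespace HypMfd

/-! ### Automorphisms of lattices that are close to the identity -/

section Lattice

variable {E : Type*} [AddCommGroup E]

/-- The binomial expansion with the tail kept as `θ ^ 3 * κ`, so that it retains the divisibility of
`θ ^ 3`. -/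
theorem exists_one_add_pow_eq {R : Type*} [Ring R] (θ : R) (n : ℕ) :
    ∃ κ : R, (1 + θ) ^ n = 1 + (n : R) * θ + (n.choose 2 : R) * θ ^ 2 + θ ^ 3 * κ := by
  induction n with
  | zero => exact ⟨0, by simp⟩
  | succ n ih =>
    obtain ⟨κ, hκ⟩ := ih
    refine ⟨n.choose 2 + κ + θ * κ, ?_⟩
    have ech : (n + 1).choose 2 = n + n.choose 2 := by
      rw [Nat.choose_succ_succ' n 1, Nat.choose_one_right]
    have c1 : θ * (n : R) = n * θ := (Nat.cast_commute n θ).eq.symm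
    have c2 : ∀ x : R, x * (n.choose 2 : R) = n.choose 2 * x := fun x =>
      (Nat.cast_commute _ x).eq.symm
    rw [pow_succ', hκ, ech]
    push_cast
    simp only [mul_add, add_mul, one_mul, mul_one, ← mul_assoc, c1, c2, pow_succ, pow_zero]
    noncomm_ring

/-- An endomorphism of order `p` of a torsion-free group that is congruent to the identity
modulo `p ^ s` is congruent to the identity modulo `p ^ (s + 1)`. -/
theorem sub_self_mem_pow_succ {p : ℕ} (hp : p.Prime)
    (htf : ∀ (n : ℕ) (u : E), n ≠ 0 → n • u = 0 → u = 0) {s : ℕ} (hs : 1 ≤ s)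
    (hs2 : p = 2 → 2 ≤ s) (φ : AddMonoid.End E) (hφ : φ ^ p = 1)
    (h : ∀ u, ∃ w, φ u - u = p ^ s • w) (u : E) : ∃ w, φ u - u = p ^ (s + 1) • w := by
  set θ : AddMonoid.End E := φ - 1 with hθ
  have hθu : ∀ u, ∃ w, θ u = p ^ s • w := h
  have hθ2 : ∀ u, ∃ w, (θ ^ 2) u = p ^ (s + s) • w := by
    intro u
    obtain ⟨w, hw⟩ := hθu u
    obtain ⟨w', hw'⟩ := hθu w
    refine ⟨w', ?_⟩
    rw [pow_two]
    change θ (θ u) = _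
    rw [hw, map_nsmul, hw', smul_smul, pow_add]
  have hθ3 : ∀ u, ∃ w, (θ ^ 3) u = p ^ (s + s + s) • w := by
    intro u
    obtain ⟨w, hw⟩ := hθ2 u
    obtain ⟨w', hw'⟩ := hθu w
    refine ⟨w', ?_⟩
    rw [pow_succ']
    change θ ((θ ^ 2) u) = _
    rw [hw, map_nsmul, hw', smul_smul, pow_add _ (s + s)]
  -- Solve `(1 + θ) ^ p = 1` for `p • θ`. For `p = 2` the right side is divisible by `2 ^ (2 * s)`,
  -- which suffices as `2 ≤ s`; for odd `p` the two terms carry `p ^ (2 * s + 1)` and `p ^ (3 * s)`,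
  -- which suffice as `1 ≤ s`. Cancelling one `p` then uses torsion-freeness.
  have key : ∃ w, p • θ u = p ^ (s + 2) • w := by
    obtain ⟨w2, hw2⟩ := hθ2 u
    by_cases hp2 : p = 2
    · subst hp2
      have e : (1 + θ) ^ 2 = 1 := by rw [hθ, add_sub_cancel, hφ]
      have e2 : (2 : ℕ) • θ + θ ^ 2 = 0 := by
        have : (1 + θ) ^ 2 = 1 + ((2 : ℕ) • θ + θ ^ 2) := by noncomm_ring
        rw [this] at e
        simpa using e
      have e3 := congrArg (fun f : AddMonoid.End E => f u) e2
      have e4 : (2 : ℕ) • θ u + (θ ^ 2) u = 0 := e3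
      refine ⟨-((2 ^ (s - 2)) • w2), ?_⟩
      rw [eq_neg_of_add_eq_zero_left e4, hw2, smul_neg, smul_smul, ← pow_add]
      congr 3
      have := hs2 rfl
      omega
    · obtain ⟨κ, hκ⟩ := exists_one_add_pow_eq θ p
      obtain ⟨w3, hw3⟩ := hθ3 (κ u)
      have hdvd : p ∣ p.choose 2 := hp.dvd_choose_self (by norm_num) (by
        have := hp.two_le; omega)
      obtain ⟨c, hc⟩ := hdvd
      have e : (1 + θ) ^ p = 1 := by rw [hθ, add_sub_cancel, hφ]
      rw [hκ, add_assoc, add_assoc, add_eq_left] at e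
      have e3 := congrArg (fun f : AddMonoid.End E => f u) e
      have e4 : p • θ u + (p.choose 2 • (θ ^ 2) u + (θ ^ 3) (κ u)) = 0 := by
        rw [← nsmul_eq_mul, ← nsmul_eq_mul] at e3
        exact e3
      refine ⟨-((c * p ^ (s - 1)) • w2 + (p ^ (s + s - 2)) • w3), ?_⟩
      rw [eq_neg_of_add_eq_zero_left e4, hw2, hw3, smul_neg, smul_add, smul_smul, smul_smul,
        smul_smul, hc]
      congr 3
      · rw [show s + s = (s - 1) + s + 1 by omega]; ring
      · rw [← pow_add]; congr 1; omega
  obtain ⟨w, hw⟩ := key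
  refine ⟨w, ?_⟩
  have e : p • (θ u - p ^ (s + 1) • w) = 0 := by
    rw [smul_sub, hw, smul_smul, ← pow_succ', sub_self]
  exact sub_eq_zero.1 (htf p _ hp.ne_zero e)

/-- An automorphism of `p`-power order of a torsion-free `p`-adically separated group that is
congruent to the identity modulo `p` (modulo `4` if `p = 2`) is the identity. -/
theorem eq_one_of_congr_one {p : ℕ} (hp : p.Prime)
    (htf : ∀ (n : ℕ) (u : E), n ≠ 0 → n • u = 0 → u = 0)
    (hsep : ∀ u : E, (∀ n : ℕ, ∃ w, u = p ^ n • w) → u = 0)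
    (φ : AddMonoid.End E) (h : ∀ u, ∃ w, φ u - u = powExp p • w) (e : ℕ) (hφ : φ ^ p ^ e = 1) :
    φ = 1 := by
  obtain ⟨s, hs1, hs2, hs⟩ : ∃ s, 1 ≤ s ∧ (p = 2 → 2 ≤ s) ∧ powExp p = p ^ s := by
    by_cases hp2 : p = 2
    · exact ⟨2, by norm_num, fun _ => le_rfl, by simp [powExp, hp2]⟩
    · exact ⟨1, le_rfl, fun h => absurd h hp2, by simp [powExp, hp2]⟩
  rw [hs] at h
  have base : ∀ ψ : AddMonoid.End E, (∀ u, ∃ w, ψ u - u = p ^ s • w) → ψ ^ p = 1 → ψ = 1 := by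
    intro ψ hψ hψp
    have hall : ∀ n : ℕ, ∀ u, ∃ w, ψ u - u = p ^ (s + n) • w := by
      intro n
      induction n with
      | zero => exact hψ
      | succ n ih =>
        exact sub_self_mem_pow_succ hp htf (hs1.trans (Nat.le_add_right s n))
          (fun h => (hs2 h).trans (Nat.le_add_right s n)) ψ hψp ih
    ext u
    refine sub_eq_zero.1 (hsep _ fun n => ?_)
    obtain ⟨w, hw⟩ := hall n u
    exact ⟨p ^ s • w, by
      rw [smul_smul, ← pow_add, add_comm n]; exact hw⟩
  have hpow : ∀ n : ℕ, ∀ u, ∃ w, (φ ^ n) u - u = p ^ s • w := by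
    intro n
    induction n with
    | zero => exact fun u => ⟨0, by simp⟩
    | succ n ih =>
      intro u
      obtain ⟨w, hw⟩ := ih (φ u)
      obtain ⟨w', hw'⟩ := h u
      refine ⟨w + w', ?_⟩
      rw [smul_add, ← hw, ← hw', pow_succ]
      exact (sub_add_sub_cancel _ _ _).symm
  induction e with
  | zero => simpa using hφ
  | succ e ih =>
    apply ih
    apply base _ (hpow _)
    rw [← pow_mul, ← pow_succ, hφ]

/-- The group is free, and a nonzero integer coordinate is divisible by only finitely many powers of
`p`. -/
theorem eq_zero_of_forall_pow_dvd [Module.Finite ℤ E]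
    (htf : ∀ (n : ℕ) (u : E), n ≠ 0 → n • u = 0 → u = 0) {p : ℕ} (hp : p.Prime) (u : E)
    (h : ∀ n : ℕ, ∃ w, u = p ^ n • w) : u = 0 := by
  have : Module.IsTorsionFree ℤ E := by
    refine Module.IsTorsionFree.of_smul_eq_zero fun r u hru => ?_
    by_contra! hne
    exact hne.2 (htf r.natAbs u (by simpa using hne.1) (natAbs_nsmul_eq_zero.2 hru))
  let b := Module.Free.chooseBasis ℤ E
  rw [← b.repr.map_eq_zero_iff]
  ext i
  by_contra hne
  have hd : ∀ n : ℕ, ((p : ℤ) ^ n) ∣ b.repr u i := by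
    intro n
    obtain ⟨w, hw⟩ := h n
    exact ⟨b.repr w i, by rw [hw, map_nsmul]; simp⟩
  have := Int.finiteMultiplicity_iff (a := (p : ℤ)) (b := b.repr u i)
  have h2 := this.2 ⟨by simpa using hp.ne_one, hne⟩
  obtain ⟨n, hn⟩ := h2
  exact hn (hd _)

end Lattice
end HypMfd
end

noncomputable section
namespace HypMfd

/-! ### Finite `p`-quotients of a `p`-powerful group have kernels without rational characters -/

section Characters

open Subgroup
open scoped commutatorElement

theorem exists_pow_eq_of_mem_powSub {G : Type*} [Group G] {A : Subgroup G}
    (hcomm : ∀ a ∈ A, ∀ b ∈ A, Commute a b) {m : ℕ} {x : G} (hx : x ∈ powSub A m) :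
    ∃ a ∈ A, a ^ m = x := by
  induction hx using Subgroup.closure_induction with
  | mem y hy =>
    obtain ⟨a, ha, rfl⟩ := hy
    exact ⟨a, ha, rfl⟩
  | one => exact ⟨1, A.one_mem, one_pow m⟩
  | mul y z _ _ ihy ihz =>
    obtain ⟨a, ha, rfl⟩ := ihy
    obtain ⟨b, hb, rfl⟩ := ihz
    exact ⟨a * b, A.mul_mem ha hb, (hcomm a ha b hb).mul_pow m⟩
  | inv y _ ihy =>
    obtain ⟨a, ha, rfl⟩ := ihy
    exact ⟨a⁻¹, A.inv_mem ha, inv_pow a m⟩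

theorem eq_one_of_forall_pow {G : Type*} [Group G] {A : Subgroup G} (hfg : A.FG)
    (hcomm : ∀ a ∈ A, ∀ b ∈ A, Commute a b)
    (htf : ∀ a ∈ A, ∀ n : ℕ, n ≠ 0 → a ^ n = 1 → a = 1) {p : ℕ} (hp : p.Prime) {a : G}
    (ha : a ∈ A) (h : ∀ n : ℕ, ∃ w ∈ A, a = w ^ p ^ n) : a = 1 := by
  let _ : CommGroup A :=
    { (inferInstance : Group A) with mul_comm := fun a b => Subtype.ext (hcomm a a.2 b b.2) }
  have hfin : Module.Finite ℤ (Additive A) := by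
    have h1 : Group.FG A := (Group.fg_iff_subgroup_fg A).2 hfg
    have h2 : AddGroup.FG (Additive A) := GroupFG.iff_add_fg.1 h1
    exact Module.Finite.iff_addGroup_fg.2 h2
  have := eq_zero_of_forall_pow_dvd (E := Additive A)
    (fun n u hn hu => by
      have : (u.toMul : G) ^ n = 1 := by
        have := congrArg (fun v : Additive A => (v.toMul : G)) hu
        simpa using this
      have := htf _ u.toMul.2 n hn this
      exact Additive.toMul.injective (Subtype.ext this)) hp (Additive.ofMul ⟨a, ha⟩)
    (fun n => by
      obtain ⟨w, hw, hwa⟩ := h n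
      exact ⟨Additive.ofMul ⟨w, hw⟩, Additive.toMul.injective (Subtype.ext (by simpa using hwa))⟩)
  have := congrArg (fun v : Additive A => (v.toMul : G)) this
  simpa using this

/-- The quotient of `A` by its `m`-th powers is a finitely generated abelian torsion group, hence
finite. -/
theorem finiteIndex_powSub {G : Type*} [Group G] {A : Subgroup G} [A.FiniteIndex] (hfg : A.FG)
    (hcomm : ∀ a ∈ A, ∀ b ∈ A, Commute a b) {m : ℕ} (hm : m ≠ 0) :
    (powSub A m).FiniteIndex := by
  let _ : CommGroup A :=
    { (inferInstance : Group A) with mul_comm := fun a b => Subtype.ext (hcomm a a.2 b b.2) }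
  have h1 : Group.FG A := (Group.fg_iff_subgroup_fg A).2 hfg
  have h2 : Finite (A ⧸ (powSub A m).subgroupOf A) := by
    apply CommGroup.finite_of_fg_isMulTorsion
    intro x
    obtain ⟨a, rfl⟩ := QuotientGroup.mk_surjective x
    refine isOfFinOrder_iff_pow_eq_one.2 ⟨m, Nat.pos_of_ne_zero hm, ?_⟩
    rw [← QuotientGroup.mk_pow, QuotientGroup.eq_one_iff]
    exact pow_mem_powSub a.2 m
  have h3 : ((powSub A m).subgroupOf A).index ≠ 0 := Subgroup.index_ne_zero_of_finite
  refine ⟨?_⟩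
  rw [← Subgroup.relIndex_mul_index (powSub_le_self A m)]
  exact mul_ne_zero h3 Subgroup.FiniteIndex.index_ne_zero

/-- A powerful finite quotient shows that `g` acts on the lattice `U` trivially modulo `powExp p`.
Some `p`-power of `g` lies in the abelian group `A` and acts trivially, so Minkowski's argument
applies. -/
theorem commute_of_powerful {G : Type} [Group G] {p : ℕ} (hp : p.Prime) {A : Subgroup G}
    [A.Normal] [A.FiniteIndex] (hGA : IsPGroup p (G ⧸ A)) (hfg : A.FG)
    (hcomm : ∀ a ∈ A, ∀ b ∈ A, Commute a b)
    (htf : ∀ a ∈ A, ∀ n : ℕ, n ≠ 0 → a ^ n = 1 → a = 1) (hpow : IsPPowerful p G) {i : ℕ}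
    (hi : powIter G p i ≤ A) {u : G} (hu : u ∈ powIter G p i) (g : G) : Commute g u := by
  have := Fact.mk hp
  set U := powIter G p i with hU
  have hUcomm : ∀ a ∈ U, ∀ b ∈ U, Commute a b := fun a ha b hb => hcomm a (hi ha) b (hi hb)
  have hle : ⁅U, (⊤ : Subgroup G)⁆ ≤ powSub U (powExp p) := by
    -- The exponent is chosen so that `B` lies in `powSub U (powExp p)`: `p ^ i`-th powers land in
    -- `U`, and `powExp p` divides `p ^ 2`. An inclusion proved modulo `B` then holds in `G` itself.
    set B := powSub A (p ^ (i + 2)) with hB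
    have hBfin : B.FiniteIndex := finiteIndex_powSub hfg hcomm (pow_ne_zero _ hp.ne_zero)
    have hBp : IsPGroup p (G ⧸ B) := by
      intro x
      obtain ⟨g, rfl⟩ := QuotientGroup.mk_surjective x
      obtain ⟨e, he⟩ := hGA (QuotientGroup.mk g)
      rw [← QuotientGroup.mk_pow, QuotientGroup.eq_one_iff] at he
      refine ⟨e + (i + 2), ?_⟩
      rw [← QuotientGroup.mk_pow, QuotientGroup.eq_one_iff, pow_add, pow_mul]
      exact pow_mem_powSub he _
    have hBU : B ≤ powSub U (powExp p) := by
      refine powSub_le_iff.2 fun a _ => ?_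
      obtain ⟨c, hc⟩ : powExp p ∣ p ^ 2 := by
        by_cases h2 : p = 2
        · simp [powExp, h2]
        · simp [powExp, h2, pow_two]
      rw [pow_add, hc, mul_comm (powExp p), ← mul_assoc, pow_mul, pow_mul]
      exact pow_mem_powSub (U.pow_mem (pow_mem_powIter a p i) c) _
    have hpw : commutator (G ⧸ B) ≤ powSub ⊤ (powExp p) := by
      have := hpow B inferInstance hBp
      rw [IsPowerful] at this
      rw [powSub, Subgroup.coe_top, Set.image_univ]
      exact this
    have hnil : Group.IsNilpotent (G ⧸ B) := hBp.isNilpotent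
    have h1 := commutator_powIter_le hp hpw i
    rw [← map_powIter (QuotientGroup.mk' B) (QuotientGroup.mk'_surjective B), ← map_powSub,
      ← Subgroup.map_top_of_surjective (QuotientGroup.mk' B) (QuotientGroup.mk'_surjective B),
      ← Subgroup.map_commutator, Subgroup.map_le_iff_le_comap, QuotientGroup.comap_map_mk',
      sup_eq_right.2 hBU] at h1
    exact h1
  let _ : CommGroup U :=
    { (inferInstance : Group U) with mul_comm := fun a b => Subtype.ext (hUcomm a a.2 b b.2) }
  let φ : AddMonoid.End (Additive U) := MonoidHom.toAdditive
    ((MulAut.conjNormal g : U ≃* U).toMonoidHom)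
  have hφ : ∀ v : Additive U, ((φ v).toMul : G) = g * v.toMul * g⁻¹ := fun v => rfl
  have hφpow : ∀ (n : ℕ) (v : Additive U), (((φ ^ n) v).toMul : G) = g ^ n * v.toMul * (g ^ n)⁻¹ := by
    intro n
    induction n with
    | zero => intro v; simp
    | succ n ih =>
      intro v
      rw [pow_succ]
      change (((φ ^ n) (φ v)).toMul : G) = _
      rw [ih, hφ, pow_succ]
      simp [mul_assoc]
  obtain ⟨e, he⟩ := hGA (QuotientGroup.mk g)
  rw [← QuotientGroup.mk_pow, QuotientGroup.eq_one_iff] at he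
  have hone : φ = 1 := by
    refine eq_one_of_congr_one hp ?_ ?_ φ ?_ e ?_
    · intro n v hn hv
      have h1 : (v.toMul : G) ^ n = 1 := by
        have := congrArg (fun v : Additive U => (v.toMul : G)) hv
        simpa using this
      exact Additive.toMul.injective (Subtype.ext (htf _ (hi v.toMul.2) n hn h1))
    · intro v hv
      refine Additive.toMul.injective (Subtype.ext ?_)
      refine eq_one_of_forall_pow hfg hcomm htf hp (hi v.toMul.2) fun n => ?_
      obtain ⟨w, hw⟩ := hv n
      refine ⟨w.toMul, hi w.toMul.2, ?_⟩
      have := congrArg (fun v : Additive U => (v.toMul : G)) hw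
      simpa using this
    · intro v
      have h1 : ⁅g, (v.toMul : G)⁆ ∈ powSub U (powExp p) := by
        apply hle
        rw [Subgroup.commutator_comm]
        exact Subgroup.commutator_mem_commutator trivial v.toMul.2
      obtain ⟨w, hw, hwe⟩ := exists_pow_eq_of_mem_powSub hUcomm h1
      refine ⟨Additive.ofMul ⟨w, hw⟩, Additive.toMul.injective (Subtype.ext ?_)⟩
      change ((φ v).toMul : G) / (v.toMul : G) = w ^ powExp p
      rw [hφ, hwe, div_eq_mul_inv, commutatorElement_def]
    · ext v
      rw [hφpow]
      have : Commute (g ^ p ^ e) (v.toMul : G) := hcomm _ he _ (hi v.toMul.2)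
      rw [this.eq, mul_inv_cancel_right]
      rfl
  have h1 := hφ (Additive.ofMul ⟨u, hu⟩)
  rw [hone] at h1
  exact (eq_mul_inv_iff_mul_eq.1 h1).symm

/-- Rational characters separate points, so `A` is abelian and torsion-free. A deep power subgroup
is central of finite index, and the transfer to the centre, a power map, carries characters of `A`
back to `G`. -/
theorem eq_bot_of_powerful {G : Type} [Group G] {p : ℕ} (hp : p.Prime) (A : Subgroup G)
    [A.Normal] [A.FiniteIndex] (hGA : IsPGroup p (G ⧸ A)) (hfg : A.FG)
    (hsep : ∀ a : A, a ≠ 1 → ∃ φ : A →* Multiplicative ℚ, φ a ≠ 1) (hpow : IsPPowerful p G)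
    (hhom : ∀ f : G →* Multiplicative ℚ, f = 1) : A = ⊥ := by
  have hcomm : ∀ a ∈ A, ∀ b ∈ A, Commute a b := by
    intro a ha b hb
    by_contra hne
    obtain ⟨φ, hφ⟩ := hsep ⁅(⟨a, ha⟩ : A), ⟨b, hb⟩⁆ fun h =>
      hne (congrArg Subtype.val (commutatorElement_eq_one_iff_mul_comm.1 h))
    refine hφ ?_
    rw [map_commutatorElement]
    exact commutatorElement_eq_one_iff_mul_comm.2 (mul_comm _ _)
  have hQ : ∀ (q : Multiplicative ℚ) (n : ℕ), n ≠ 0 → q ^ n = 1 → q = 1 := by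
    intro q n hn h
    have : n • q.toAdd = 0 := congrArg Multiplicative.toAdd h
    rw [smul_eq_zero] at this
    exact Multiplicative.toAdd.injective (this.resolve_left hn)
  have htf : ∀ a ∈ A, ∀ n : ℕ, n ≠ 0 → a ^ n = 1 → a = 1 := by
    intro a ha n hn h
    by_contra hne
    obtain ⟨φ, hφ⟩ := hsep ⟨a, ha⟩ fun h => hne (congrArg Subtype.val h)
    refine hφ (hQ _ n hn ?_)
    rw [← map_pow]
    convert! map_one φ
    exact Subtype.ext h
  obtain ⟨i, hi⟩ := exists_powIter_eq_bot hp hGA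
  rw [← map_powIter (QuotientGroup.mk' A) (QuotientGroup.mk'_surjective A),
    Subgroup.map_eq_bot_iff, QuotientGroup.ker_mk'] at hi
  set U := powIter G p i with hU
  have hUc : U ≤ Subgroup.center G := fun u hu => Subgroup.mem_center_iff.2 fun g =>
    commute_of_powerful hp hGA hfg hcomm htf hpow hi hu g
  have hUA : powSub A (p ^ i) ≤ U := powSub_le_iff.2 fun a _ => pow_mem_powIter a p i
  have : (powSub A (p ^ i)).FiniteIndex :=
    finiteIndex_powSub hfg hcomm (pow_ne_zero _ hp.ne_zero)
  have hUfin : U.FiniteIndex := Subgroup.finiteIndex_of_le hUA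
  have hcfin : (Subgroup.center G).FiniteIndex := Subgroup.finiteIndex_of_le hUc
  set n := (Subgroup.center G).index
  set k := (A.subgroupOf (Subgroup.center G)).index with hk
  have hk0 : k ≠ 0 := Subgroup.FiniteIndex.index_ne_zero
  -- the homomorphism `g ↦ g ^ (n * k)` from `G` to `A`
  let τ : G →* A :=
    { toFun := fun g => ⟨((MonoidHom.transferCenterPow G g : Subgroup.center G) : G) ^ k, by
        have := Subgroup.pow_index_mem (A.subgroupOf (Subgroup.center G))
          (MonoidHom.transferCenterPow G g)
        exact this⟩
      map_one' := Subtype.ext (by simp)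
      map_mul' := fun x y => Subtype.ext (by
        simp only [map_mul, Subgroup.coe_mul]
        exact Commute.mul_pow (Subgroup.mem_center_iff.1
          (MonoidHom.transferCenterPow G y).2 _) k) }
  rw [eq_bot_iff]
  intro a ha
  rw [Subgroup.mem_bot]
  by_contra hne
  have hτ : (τ a : G) = a ^ (n * k) := by
    change ((MonoidHom.transferCenterPow G a : Subgroup.center G) : G) ^ k = _
    rw [MonoidHom.transferCenterPow_apply, pow_mul]
  have hτ1 : τ a ≠ 1 := fun h => hne (htf a ha (n * k)
    (mul_ne_zero Subgroup.FiniteIndex.index_ne_zero hk0) (by rw [← hτ, h]; rfl))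
  obtain ⟨φ, hφ⟩ := hsep _ hτ1
  exact hφ (DFunLike.congr_fun (hhom (φ.comp τ)) a)

theorem IsPPowerful.of_surjective {p : ℕ} {G H : Type} [Group G] [Group H] (f : G →* H)
    (hf : Function.Surjective f) (hG : IsPPowerful p G) : IsPPowerful p H := by
  intro N _ hfin hN
  let e : G ⧸ N.comap f →* H ⧸ N := QuotientGroup.map _ _ f le_rfl
  have hinj : Function.Injective e := by
    rw [injective_iff_map_eq_one]
    intro x hx
    obtain ⟨g, rfl⟩ := QuotientGroup.mk_surjective x
    exact (QuotientGroup.eq_one_iff g).2 ((QuotientGroup.eq_one_iff (f g)).1 hx)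
  have hsurj : Function.Surjective e := by
    intro y
    obtain ⟨h, rfl⟩ := QuotientGroup.mk_surjective y
    obtain ⟨g, rfl⟩ := hf h
    exact ⟨QuotientGroup.mk g, rfl⟩
  have h1 := hG (N.comap f) (Finite.of_injective e hinj) (hN.of_injective e hinj)
  have h2 := Subgroup.map_mono (f := e) h1
  rw [commutator_def, Subgroup.map_commutator, Subgroup.map_top_of_surjective e hsurj,
    MonoidHom.map_closure, ← Set.range_comp] at h2
  refine h2.trans (Subgroup.closure_mono ?_)
  rintro _ ⟨x, rfl⟩
  exact ⟨e x, (map_pow e x _).symm⟩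

/-- A finite-index normal subgroup of `p`-power index of a finitely generated `p`-powerful group
without nontrivial rational characters has no nontrivial rational characters. -/
theorem character_eq_one_of_powerful {G : Type} [Group G] [Group.FG G] {p : ℕ} (hp : p.Prime)
    (N : Subgroup G) [N.Normal] [N.FiniteIndex] (hGN : IsPGroup p (G ⧸ N))
    (hpow : IsPPowerful p G) (hhom : ∀ f : G →* Multiplicative ℚ, f = 1)
    (χ : N →* Multiplicative ℚ) : χ = 1 := by
  -- the intersection of the kernels of all rational characters of `N`
  let T : Subgroup G :=
    { carrier := {x | ∃ h : x ∈ N, ∀ φ : N →* Multiplicative ℚ, φ ⟨x, h⟩ = 1}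
      one_mem' := ⟨N.one_mem, fun φ => map_one φ⟩
      mul_mem' := by
        rintro x y ⟨hx, hx'⟩ ⟨hy, hy'⟩
        refine ⟨N.mul_mem hx hy, fun φ => ?_⟩
        have := map_mul φ ⟨x, hx⟩ ⟨y, hy⟩
        rw [hx', hy', one_mul] at this
        exact this
      inv_mem' := by
        rintro x ⟨hx, hx'⟩
        refine ⟨N.inv_mem hx, fun φ => ?_⟩
        have := map_inv φ ⟨x, hx⟩
        rw [hx', inv_one] at this
        exact this }
  have hTN : T ≤ N := fun x hx => hx.1
  have hTn : T.Normal := by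
    refine ⟨fun x hx g => ⟨Subgroup.Normal.conj_mem inferInstance x hx.1 g, fun φ => ?_⟩⟩
    exact hx.2 (φ.comp (MulAut.conjNormal g : N ≃* N).toMonoidHom)
  have hNfg : N.FG := by
    have : Group.FG N := Subgroup.fg_of_index_ne_zero N
    exact (Group.fg_iff_subgroup_fg N).1 this
  set π := QuotientGroup.mk' T
  have hπ := QuotientGroup.mk'_surjective T
  set A := N.map π with hA
  have hcomap : A.comap π = N := by
    rw [hA, QuotientGroup.comap_map_mk', sup_eq_right.2 hTN]
  have hAn : A.Normal := Subgroup.Normal.map inferInstance _ hπ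
  have hAfin : A.FiniteIndex := ⟨by
    rw [← Subgroup.index_comap_of_surjective A hπ, hcomap]
    exact Subgroup.FiniteIndex.index_ne_zero⟩
  have hAp : IsPGroup p ((G ⧸ T) ⧸ A) := by
    intro x
    obtain ⟨y, rfl⟩ := QuotientGroup.mk_surjective x
    obtain ⟨g, rfl⟩ := hπ y
    obtain ⟨e, he⟩ := hGN (QuotientGroup.mk g)
    refine ⟨e, ?_⟩
    rw [← QuotientGroup.mk_pow, QuotientGroup.eq_one_iff] at he ⊢
    rw [← map_pow]
    exact Subgroup.mem_map_of_mem π he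
  have hAfg : A.FG := by
    classical
    obtain ⟨S, hS⟩ := hNfg
    exact ⟨S.image π, by rw [Finset.coe_image, ← MonoidHom.map_closure, hS]⟩
  have hbot : A = ⊥ := by
    refine eq_bot_of_powerful hp A hAp hAfg ?_ (hpow.of_surjective π hπ) ?_
    · rintro ⟨a, x, hx, rfl⟩ hne
      have hxT : x ∉ T := fun h => hne (Subtype.ext ((QuotientGroup.eq_one_iff x).2 h))
      obtain ⟨φ, hφ⟩ : ∃ φ : N →* Multiplicative ℚ, φ ⟨x, hx⟩ ≠ 1 := by
        by_contra! hall
        exact hxT ⟨hx, hall⟩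
      let ρ : N →* A := π.subgroupMap N
      have hρ : Function.Surjective ρ := π.subgroupMap_surjective N
      have hker : ρ.ker ≤ φ.ker := by
        intro y hy
        have : (y : G) ∈ T := (QuotientGroup.eq_one_iff (y : G)).1 (congrArg Subtype.val hy)
        exact this.2 φ
      refine ⟨ρ.liftOfSurjective hρ ⟨φ, hker⟩, ?_⟩
      have := MonoidHom.liftOfRightInverse_comp_apply ρ _ (Function.rightInverse_surjInv hρ)
        ⟨φ, hker⟩ ⟨x, hx⟩
      intro h
      exact hφ (this.symm.trans h)
    · intro f
      have := hhom (f.comp π)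
      exact QuotientGroup.monoidHom_ext _ this
  rw [Subgroup.map_eq_bot_iff, QuotientGroup.ker_mk'] at hbot
  ext x
  exact congrArg Multiplicative.toAdd ((hbot x.2).2 χ)

end Characters
end HypMfd
end

noncomputable section
namespace HypMfd
open scoped TensorProduct
open Matrix

/-! ### Quadratic equations over the completion of a discretely valued field -/

section Hensel

variable {K : Type} [Field K] (V : ValuationSubring K)

/-- Values at most one are powers of the value of `ϖ`. This is where discreteness enters; it turns
estimates by powers of `ϖ` into Cauchy estimates. -/
theorem exists_valuation_pow_lt [IsDiscreteValuationRing V] {ϖ : V} (hϖ : Irreducible ϖ)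
    {γ : V.ValueGroup} (hγ : γ ≠ 0) : ∃ n : ℕ, V.valuation (ϖ : K) ^ n < γ := by
  have hlt : V.valuation (ϖ : K) < 1 := (V.valuation_lt_one_iff ϖ).1 (by
    rw [IsLocalRing.mem_maximalIdeal]
    exact hϖ.not_isUnit)
  have hpos : 0 < V.valuation (ϖ : K) := by
    rw [zero_lt_iff, ne_eq, map_eq_zero]
    exact fun h => hϖ.ne_zero (Subtype.ext h)
  obtain ⟨x, rfl⟩ := V.valuation_surjective γ
  have hx : x ≠ 0 := by
    rintro rfl
    exact hγ (map_zero _)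
  by_cases h1 : V.valuation x ≤ 1
  · have hxV := V.mem_of_valuation_le_one x h1
    obtain ⟨n, u, hu⟩ := IsDiscreteValuationRing.eq_unit_mul_pow_irreducible
      (x := (⟨x, hxV⟩ : V)) (fun h => hx (congrArg Subtype.val h)) hϖ
    have hxe : x = (u : V) * (ϖ : K) ^ n := congrArg Subtype.val hu
    refine ⟨n + 1, ?_⟩
    rw [hxe, map_mul, V.valuation_unit, one_mul, map_pow, pow_succ]
    exact mul_lt_of_lt_one_right (pow_pos hpos n) hlt
  · exact ⟨0, by rw [pow_zero]; exact not_le.1 h1⟩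

/-- A separable quadratic equation that splits modulo the maximal ideal splits over the
completion. -/
theorem exists_completion_root [IsDiscreteValuationRing V] {c : K} (hc : V.valuation c < 1) :
    ∃ y : V.valuation.Completion, y ^ 2 - y + algebraMap K V.valuation.Completion c = 0 := by
  obtain ⟨ϖ, hϖ⟩ := IsDiscreteValuationRing.exists_irreducible V
  set v := V.valuation with hv
  have hle : ∀ z : K, v z < 1 → v z ≤ v (ϖ : K) := by
    intro z hz
    have hzV := V.mem_of_valuation_le_one z hz.le
    have hm : (⟨z, hzV⟩ : V) ∈ IsLocalRing.maximalIdeal V := (V.valuation_lt_one_iff _).2 hz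
    rw [hϖ.maximalIdeal_eq, Ideal.mem_span_singleton] at hm
    obtain ⟨w, hw⟩ := hm
    have hze : z = (ϖ : K) * w := congrArg Subtype.val hw
    rw [hze, map_mul]
    exact mul_le_of_le_one_right' (V.valuation_le_one w)
  -- Fixed-point iteration for `y = y ^ 2 + c` from `0`. It stays in the maximal ideal, and the
  -- difference of consecutive terms is multiplied by `a (n + 1) + a n`, so it gains a factor `ϖ` at
  -- each step.
  obtain ⟨a, ha0, ha⟩ : ∃ a : ℕ → K, a 0 = 0 ∧ ∀ n, a (n + 1) = a n ^ 2 + c :=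
    ⟨fun n => Nat.rec 0 (fun _ x => x ^ 2 + c) n, rfl, fun n => rfl⟩
  have ha1 : ∀ n, v (a n) < 1 := by
    intro n
    induction n with
    | zero => rw [ha0, map_zero]; exact zero_lt_one
    | succ n ih =>
      rw [ha]
      refine lt_of_le_of_lt (v.map_add _ _) (max_lt ?_ hc)
      rw [map_pow]
      exact pow_lt_one₀ zero_le ih two_ne_zero
  have hd : ∀ n, v (a (n + 1) - a n) ≤ v (ϖ : K) ^ n := by
    intro n
    induction n with
    | zero =>
      rw [pow_zero]
      exact (v.map_sub _ _).trans (max_le (ha1 _).le (ha1 _).le)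
    | succ n ih =>
      have e : a (n + 1 + 1) - a (n + 1) = (a (n + 1) - a n) * (a (n + 1) + a n) := by
        rw [ha (n + 1), ha n]; ring
      rw [e, map_mul, pow_succ]
      exact mul_le_mul' ih (hle _ (lt_of_le_of_lt (v.map_add _ _) (max_lt (ha1 _) (ha1 _))))
  have hϖ1 : v (ϖ : K) ≤ 1 := V.valuation_le_one ϖ
  have hdd : ∀ n k, v (a (n + k) - a n) ≤ v (ϖ : K) ^ n := by
    intro n k
    induction k with
    | zero => simp
    | succ k ih =>
      have e : a (n + (k + 1)) - a n = (a (n + k + 1) - a (n + k)) + (a (n + k) - a n) := by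
        rw [← add_assoc]; ring
      rw [e]
      refine (v.map_add _ _).trans (max_le ((hd _).trans ?_) ih)
      exact pow_le_pow_right_of_le_one' hϖ1 (Nat.le_add_right n k)
  let b : ℕ → WithVal v := fun n => WithVal.toVal v (a n)
  have hb : CauchySeq b := by
    refine Valued.cauchy_iff.2 ⟨inferInstance, fun γ => ?_⟩
    have hγ : MonoidWithZeroHom.ValueGroup₀.embedding γ.1 ≠ 0 := by simp
    obtain ⟨N, hN⟩ := exists_valuation_pow_lt V hϖ hγ
    refine ⟨b '' Set.Ici N, Filter.image_mem_map (Filter.Ici_mem_atTop N), ?_⟩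
    have hmem : ∀ m, N ≤ m → v (a m - a N) ≤ v (ϖ : K) ^ N := by
      intro m hm
      obtain ⟨k, rfl⟩ := Nat.exists_eq_add_of_le hm
      exact hdd N k
    rintro _ ⟨m, hm, rfl⟩ _ ⟨m', hm', rfl⟩
    rw [Valuation.restrict_lt_iff_lt_embedding]
    refine lt_of_le_of_lt ?_ hN
    change v (a m' - a m) ≤ _
    have e : a m' - a m = (a m' - a N) - (a m - a N) := by ring
    rw [e]
    exact (v.map_sub _ _).trans (max_le (hmem _ hm') (hmem _ hm))
  have hb' : CauchySeq (fun n => ((b n : WithVal v) : v.Completion)) :=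
    hb.map (UniformSpace.Completion.uniformContinuous_coe _)
  obtain ⟨y, hy⟩ := cauchySeq_tendsto_of_complete hb'
  refine ⟨y, ?_⟩
  have h1 : Filter.Tendsto (fun n => ((b (n + 1) : WithVal v) : v.Completion)) Filter.atTop
      (nhds y) := hy.comp (Filter.tendsto_add_atTop_nat 1)
  have h2 : Filter.Tendsto (fun n => ((b n : WithVal v) : v.Completion) ^ 2 +
      algebraMap K v.Completion c) Filter.atTop (nhds (y ^ 2 + algebraMap K v.Completion c)) :=
    (hy.pow 2).add_const _
  have h3 : (fun n => ((b (n + 1) : WithVal v) : v.Completion)) =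
      fun n => ((b n : WithVal v) : v.Completion) ^ 2 + algebraMap K v.Completion c := by
    ext n
    change ((b (n + 1) : WithVal v) : v.Completion) =
      (b n : v.Completion) ^ 2 + ((WithVal.toVal v c : WithVal v) : v.Completion)
    rw [pow_two, ← UniformSpace.Completion.coe_mul, ← UniformSpace.Completion.coe_add]
    exact congrArg (fun x : K => ((WithVal.toVal v x : WithVal v) : v.Completion))
      ((ha n).trans (by rw [pow_two]; rfl))
  rw [h3] at h1
  have := tendsto_nhds_unique h2 h1
  linear_combination this

end Hensel

/-! ### Subalgebras of `2 × 2` matrices that stay division algebras over a completion -/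

section Division

/-- Otherwise some linear form kills `1` but not `z`; applying it to the second tensor factor
contradicts the equality. -/
theorem mem_span_one_of_tmul_eq {K L A : Type*} [Field K] [CommRing L] [Nontrivial L] [Algebra K L]
    [Ring A] [Algebra K A] {z : A} {w : L} (h : (1 : L) ⊗ₜ[K] z = w ⊗ₜ[K] (1 : A)) :
    ∃ a : K, z = algebraMap K A a := by
  by_contra! hne
  have hz : z ∉ Submodule.span K {(1 : A)} := by
    rw [Submodule.mem_span_singleton]
    rintro ⟨a, rfl⟩
    exact hne a (Algebra.algebraMap_eq_smul_one a).symm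
  obtain ⟨f, hf, hf1⟩ := Submodule.exists_le_ker_of_notMem hz
  have hf1' : f 1 = 0 := hf1 (Submodule.mem_span_singleton_self 1)
  have e := congrArg (fun x => TensorProduct.rid K L (LinearMap.lTensor L f x)) h
  simp only [LinearMap.lTensor_tmul, TensorProduct.rid_tmul, hf1', zero_smul] at e
  rw [← Algebra.algebraMap_eq_smul_one, map_eq_zero_iff _ (algebraMap K L).injective] at e
  exact hf e

variable {R : Type*} [CommRing R]

theorem sq_eq_trace_smul_sub_det (x : Matrix (Fin 2) (Fin 2) R) :
    x ^ 2 = x.trace • x - x.det • (1 : Matrix (Fin 2) (Fin 2) R) := by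
  ext i j
  fin_cases i <;> fin_cases j <;>
    simp [pow_two, Matrix.mul_apply, Matrix.trace_fin_two, Matrix.det_fin_two, Fin.sum_univ_two] <;>
    ring

theorem adjugate_eq_trace_smul_sub (x : Matrix (Fin 2) (Fin 2) R) :
    x.adjugate = x.trace • (1 : Matrix (Fin 2) (Fin 2) R) - x := by
  ext i j
  fin_cases i <;> fin_cases j <;> simp [Matrix.adjugate_fin_two, Matrix.trace_fin_two]

theorem det_add_fin_two (x y : Matrix (Fin 2) (Fin 2) R) :
    (x + y).det = x.det + y.det + (x * y.adjugate).trace := by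
  simp [Matrix.adjugate_fin_two, Matrix.trace_fin_two, Matrix.det_fin_two, Matrix.mul_apply,
    Fin.sum_univ_two]
  ring

variable {K : Type} [Field K] [Algebra K ℂ] {A : Subalgebra K (Matrix (Fin 2) (Fin 2) ℂ)}
  {V : ValuationSubring K}

theorem eq_zero_or_eq_zero_of_mul {D : Type*} [Ring D] (hD : ∀ a : D, a ≠ 0 → IsUnit a) {a b : D}
    (h : a * b = 0) : a = 0 ∨ b = 0 := by
  by_contra! hne
  exact hne.2 ((hD a hne.1).mul_right_eq_zero.1 h)

/-- The adjugate is the quaternion conjugate and lies in the algebra, so a singular `x` would be a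
zero divisor. -/
theorem eq_zero_of_det_eq_zero
    (hD : ∀ a : V.valuation.Completion ⊗[K] A, a ≠ 0 → IsUnit a) {x : Matrix (Fin 2) (Fin 2) ℂ}
    (hx : x ∈ A) {t : K} (ht : algebraMap K ℂ t = x.trace) (hdet : x.det = 0) : x = 0 := by
  have hadj : x.adjugate ∈ A := by
    rw [adjugate_eq_trace_smul_sub, ← ht, algebraMap_smul]
    exact A.sub_mem (A.smul_mem A.one_mem t) hx
  have hinj : Function.Injective
      (Algebra.TensorProduct.includeRight : A →ₐ[K] V.valuation.Completion ⊗[K] A) :=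
    Algebra.TensorProduct.includeRight_injective (algebraMap K _).injective
  have hmul : (⟨x, hx⟩ : A) * ⟨x.adjugate, hadj⟩ = 0 :=
    Subtype.ext (by
      change x * x.adjugate = 0
      rw [Matrix.mul_adjugate, hdet, zero_smul])
  have h2 := congrArg (Algebra.TensorProduct.includeRight :
    A →ₐ[K] V.valuation.Completion ⊗[K] A) hmul
  rw [map_mul, map_zero] at h2
  rcases eq_zero_or_eq_zero_of_mul hD h2 with h | h
  · exact congrArg Subtype.val ((map_eq_zero_iff _ hinj).1 h)
  · have h3 : x.adjugate = 0 := congrArg Subtype.val ((map_eq_zero_iff _ hinj).1 h)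
    have := Matrix.adjugate_adjugate' x
    rw [h3] at this
    simpa using this.symm

/-- After scaling to trace one, Cayley-Hamilton reads `z ^ 2 - z + c = 0`. With a root `y` of this
equation in the completion, `(z - y) * (z - (1 - y)) = 0`, so the division property makes `z` a
scalar of the completion, hence of `K`. -/
theorem not_valuation_det_div_trace_sq_lt_one [IsDiscreteValuationRing V]
    (hD : ∀ a : V.valuation.Completion ⊗[K] A, a ≠ 0 → IsUnit a) {x : Matrix (Fin 2) (Fin 2) ℂ}
    (hx : x ∈ A) {t d : K} (ht : algebraMap K ℂ t = x.trace) (hd : algebraMap K ℂ d = x.det)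
    (ht0 : t ≠ 0) : ¬ V.valuation (d / t ^ 2) < 1 := by
  intro hlt
  set c := d / t ^ 2 with hc
  obtain ⟨y, hy⟩ := exists_completion_root V hlt
  let z : A := t⁻¹ • ⟨x, hx⟩
  have hz : z ^ 2 = z - algebraMap K A c := by
    apply Subtype.ext
    change (t⁻¹ • x) ^ 2 = t⁻¹ • x - algebraMap K (Matrix (Fin 2) (Fin 2) ℂ) c
    rw [smul_pow, sq_eq_trace_smul_sub_det, ← ht, ← hd, algebraMap_smul, algebraMap_smul, smul_sub,
      smul_smul, smul_smul, Algebra.algebraMap_eq_smul_one, hc]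
    congr 2
    · field_simp
    · field_simp
  set Z := (1 : V.valuation.Completion) ⊗ₜ[K] z with hZ
  set Y := y ⊗ₜ[K] (1 : A) with hY
  have hYZ : Commute Y Z := by
    rw [Commute, SemiconjBy, hY, hZ, Algebra.TensorProduct.tmul_mul_tmul,
      Algebra.TensorProduct.tmul_mul_tmul]
    simp
  have hZ2 : Z ^ 2 = Z - (algebraMap K V.valuation.Completion c) ⊗ₜ[K] (1 : A) := by
    have e : (1 : V.valuation.Completion) ⊗ₜ[K] (algebraMap K A c) =
        (algebraMap K V.valuation.Completion c) ⊗ₜ[K] (1 : A) := by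
      rw [Algebra.algebraMap_eq_smul_one, Algebra.algebraMap_eq_smul_one, TensorProduct.smul_tmul]
    rw [hZ, Algebra.TensorProduct.tmul_pow, one_pow, hz, TensorProduct.tmul_sub, e]
  have hY2 : Y ^ 2 = Y - (algebraMap K V.valuation.Completion c) ⊗ₜ[K] (1 : A) := by
    rw [hY, Algebra.TensorProduct.tmul_pow, one_pow, ← TensorProduct.sub_tmul]
    congr 1
    linear_combination hy
  have hprod : (Z - Y) * (Z - (1 - Y)) = 0 := by
    have : (Z - Y) * (Z - (1 - Y)) = Z ^ 2 - Z + (Y - Y ^ 2) + (Z * Y - Y * Z) := by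
      simp only [sub_mul, mul_sub, mul_one, pow_two]
      abel
    rw [this, hZ2, hY2, hYZ.eq]
    abel
  have hw : ∃ w : V.valuation.Completion, Z = w ⊗ₜ[K] (1 : A) := by
    rcases eq_zero_or_eq_zero_of_mul hD hprod with h | h
    · exact ⟨y, sub_eq_zero.1 h⟩
    · refine ⟨1 - y, (sub_eq_zero.1 h).trans ?_⟩
      rw [TensorProduct.sub_tmul, Algebra.TensorProduct.one_def]
  obtain ⟨w, hw⟩ := hw
  obtain ⟨a, ha⟩ := mem_span_one_of_tmul_eq hw
  have hxa : x = (t * a) • (1 : Matrix (Fin 2) (Fin 2) ℂ) := by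
    have h1 : t⁻¹ • x = a • (1 : Matrix (Fin 2) (Fin 2) ℂ) := by
      rw [← Algebra.algebraMap_eq_smul_one]
      exact congrArg Subtype.val ha
    rw [mul_smul, ← h1, smul_smul, mul_inv_cancel₀ ht0, one_smul]
  have hinj := (algebraMap K ℂ).injective
  have htr : t = 2 * (t * a) := by
    apply hinj
    rw [ht, hxa, ← algebraMap_smul ℂ (t * a), Matrix.trace_smul]
    simp only [Matrix.trace_one, Fintype.card_fin, map_mul, smul_eq_mul, map_ofNat]
    push_cast
    ring
  have hdet : d = (t * a) ^ 2 := by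
    apply hinj
    rw [hd, hxa, ← algebraMap_smul ℂ (t * a), Matrix.det_smul]
    simp
  -- A scalar of trace one is `1 / 2`, with determinant `1 / 4`; this is impossible for `c` in the
  -- maximal ideal, in every residue characteristic.
  have h4 : (4 : K) * c = 1 := by
    have h2a : 2 * a = 1 := by
      apply mul_left_cancel₀ ht0
      linear_combination -htr
    rw [hc, hdet]
    field_simp
    linear_combination (2 * a + 1) * h2a
  have h5 : V.valuation (4 : K) ≤ 1 := by
    have := V.valuation_le_one (4 : V)
    exact this
  have h6 := congrArg V.valuation h4
  rw [map_mul, map_one] at h6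
  exact (lt_of_le_of_lt (mul_le_of_le_one_left' h5) hlt).ne h6

end Division
end HypMfd
end

noncomputable section
namespace HypMfd
open scoped TensorProduct
open Matrix

/-! ### The order spanned by a group of matrices with integral traces -/

section Order

variable (R : Type*) [CommRing R] [Algebra R ℂ] (S : Subgroup SL2C)

/-- The `R`-algebra of matrices generated by the elements of `S`. -/
def matOrder : Subalgebra R (Matrix (Fin 2) (Fin 2) ℂ) :=
  Algebra.adjoin R {m | ∃ g ∈ S, m = g.1}

variable {R S}

theorem mem_matOrder {g : SL2C} (hg : g ∈ S) : g.1 ∈ matOrder R S :=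
  Algebra.subset_adjoin ⟨g, hg, rfl⟩

/-- The matrix order is spanned by the group. -/
theorem matOrder_induction {P : Matrix (Fin 2) (Fin 2) ℂ → Prop}
    (smul_mem : ∀ (r : R), ∀ g ∈ S, P (r • g.1))
    (add : ∀ x ∈ matOrder R S, ∀ y ∈ matOrder R S, P x → P y → P (x + y))
    {x : Matrix (Fin 2) (Fin 2) ℂ} (hx : x ∈ matOrder R S) : P x := by
  have hsub : ∀ y ∈ Submonoid.closure {m : Matrix (Fin 2) (Fin 2) ℂ | ∃ g ∈ S, m = g.1},
      ∃ g ∈ S, y = g.1 := by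
    intro y hy
    induction hy using Submonoid.closure_induction with
    | mem y hy => exact hy
    | one => exact ⟨1, S.one_mem, rfl⟩
    | mul y z _ _ ihy ihz =>
      obtain ⟨g, hg, rfl⟩ := ihy
      obtain ⟨h, hh, rfl⟩ := ihz
      exact ⟨g * h, S.mul_mem hg hh, rfl⟩
  have hspan : x ∈ Submodule.span R
      (Submonoid.closure {m : Matrix (Fin 2) (Fin 2) ℂ | ∃ g ∈ S, m = g.1} : Set _) := by
    rw [← Algebra.adjoin_eq_span]
    exact hx
  have hle : ∀ y, y ∈ Submodule.span R
      (Submonoid.closure {m : Matrix (Fin 2) (Fin 2) ℂ | ∃ g ∈ S, m = g.1} : Set _) →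
      y ∈ matOrder R S := fun y hy => by
    rw [← Algebra.adjoin_eq_span] at hy
    exact hy
  suffices h : x ∈ matOrder R S ∧ P x from h.2
  induction hspan using Submodule.closure_induction with
  | zero =>
    have := smul_mem 0 1 S.one_mem
    rw [zero_smul] at this
    exact ⟨zero_mem _, this⟩
  | add y z hy hz ihy ihz =>
    have h1 := ihy (hle y hy)
    have h2 := ihz (hle z hz)
    exact ⟨add_mem h1.1 h2.1, add y h1.1 z h2.1 h1.2 h2.2⟩
  | smul_mem r y hy =>
    obtain ⟨g, hg, rfl⟩ := hsub y hy
    exact ⟨(matOrder R S).smul_mem (mem_matOrder hg) r, smul_mem r g hg⟩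

theorem exists_trace_eq (htr : ∀ g ∈ S, ∃ t : R, algebraMap R ℂ t = g.1.trace)
    {x : Matrix (Fin 2) (Fin 2) ℂ} (hx : x ∈ matOrder R S) :
    ∃ t : R, algebraMap R ℂ t = x.trace := by
  refine matOrder_induction (R := R) (S := S) (P := fun x => ∃ t : R, algebraMap R ℂ t = x.trace)
    ?_ ?_ hx
  · intro r g hg
    obtain ⟨t, ht⟩ := htr g hg
    exact ⟨r * t, by rw [map_mul, ht, Matrix.trace_smul, Algebra.smul_def]⟩
  · rintro x _ y _ ⟨s, hs⟩ ⟨t, ht⟩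
    exact ⟨s + t, by rw [map_add, hs, ht, Matrix.trace_add]⟩

theorem adjugate_mem_matOrder (htr : ∀ g ∈ S, ∃ t : R, algebraMap R ℂ t = g.1.trace)
    {x : Matrix (Fin 2) (Fin 2) ℂ} (hx : x ∈ matOrder R S) :
    x.adjugate ∈ matOrder R S := by
  obtain ⟨t, ht⟩ := exists_trace_eq htr hx
  rw [adjugate_eq_trace_smul_sub, ← ht, algebraMap_smul]
  exact sub_mem ((matOrder R S).smul_mem (one_mem _) t) hx

theorem exists_det_eq (htr : ∀ g ∈ S, ∃ t : R, algebraMap R ℂ t = g.1.trace)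
    {x : Matrix (Fin 2) (Fin 2) ℂ} (hx : x ∈ matOrder R S) :
    ∃ d : R, algebraMap R ℂ d = x.det := by
  refine matOrder_induction (R := R) (S := S) (P := fun x => ∃ d : R, algebraMap R ℂ d = x.det)
    ?_ ?_ hx
  · intro r g hg
    refine ⟨r ^ 2, ?_⟩
    rw [← algebraMap_smul ℂ r, Matrix.det_smul, g.2]
    simp
  · rintro x hx y hy ⟨s, hs⟩ ⟨t, ht⟩
    obtain ⟨u, hu⟩ := exists_trace_eq htr (mul_mem hx (adjugate_mem_matOrder htr hy))
    exact ⟨s + t + u, by rw [map_add, map_add, hs, ht, hu, det_add_fin_two]⟩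

/-- A matrix order of a finitely generated group is a finitely generated module. -/
theorem matOrder_fg (htr : ∀ g ∈ S, ∃ t : R, algebraMap R ℂ t = g.1.trace)
    (hS : S.FG) : (Subalgebra.toSubmodule (matOrder R S)).FG := by
  classical
  obtain ⟨F, hF⟩ := hS
  -- a finitely generated subalgebra of the order that is stable under the involution
  have key : ∀ T : Finset SL2C, T ⊆ F → ∃ B : Subalgebra R (Matrix (Fin 2) (Fin 2) ℂ),
      B ≤ matOrder R S ∧ (Subalgebra.toSubmodule B).FG ∧ (∀ x ∈ B, x.adjugate ∈ B) ∧
      ∀ g ∈ T, g.1 ∈ B := by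
    intro T
    induction T using Finset.induction_on with
    | empty =>
      refine fun _ => ⟨⊥, bot_le, ?_, ?_, by simp⟩
      · rw [Algebra.toSubmodule_bot]
        rw [Submodule.one_eq_span]
        exact Submodule.fg_span_singleton 1
      · intro x hx
        obtain ⟨r, rfl⟩ := Algebra.mem_bot.1 hx
        rw [Algebra.algebraMap_eq_smul_one, ← algebraMap_smul ℂ r, Matrix.adjugate_smul]
        simp only [Fintype.card_fin, Matrix.adjugate_one]
        rw [show 2 - 1 = 1 from rfl, pow_one, algebraMap_smul]
        exact Subalgebra.smul_mem _ (one_mem _) r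
    | insert g T _ ih =>
      intro hT
      obtain ⟨B, hBO, hBfg, hBadj, hBT⟩ := ih ((Finset.subset_insert g T).trans hT)
      have hgS : g ∈ S := hF ▸ Subgroup.subset_closure (hT (Finset.mem_insert_self g T))
      have hgO : g.1 ∈ matOrder R S := mem_matOrder hgS
      set a := g.1 with ha
      -- With bars for adjugates, `a * b = tr (a * b) - b̄ * ā` and `ā = tr a - a`. So `a` can be
      -- moved to the right past `B`, and `B + B * a` is closed under multiplication: each generator
      -- at most doubles the number of module generators.
      have hcomm : ∀ b ∈ B, ∃ b₁ ∈ B, ∃ b₂ ∈ B, a * b = b₁ + b₂ * a := by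
        intro b hb
        obtain ⟨t, ht⟩ := exists_trace_eq htr (mul_mem hgO (hBO hb))
        obtain ⟨s, hs⟩ := exists_trace_eq htr hgO
        refine ⟨t • 1 - s • b.adjugate, sub_mem (B.smul_mem (one_mem _) t)
          (B.smul_mem (hBadj b hb) s), b.adjugate, hBadj b hb, ?_⟩
        have h1 := adjugate_eq_trace_smul_sub (a * b)
        rw [Matrix.adjugate_mul_distrib, adjugate_eq_trace_smul_sub a, ← ht, ← hs, algebraMap_smul,
          algebraMap_smul] at h1
        rw [mul_sub, mul_smul_comm, mul_one] at h1
        rw [sub_eq_sub_iff_add_eq_add] at h1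
        rw [sub_add_eq_add_sub, eq_sub_iff_add_eq]
        rw [add_comm, h1]
      have hsq : ∃ b₁ ∈ B, ∃ b₂ ∈ B, a * a = b₁ + b₂ * a := by
        obtain ⟨s, hs⟩ := exists_trace_eq htr hgO
        refine ⟨-1, neg_mem (one_mem _), s • 1, B.smul_mem (one_mem _) s, ?_⟩
        rw [← pow_two, sq_eq_trace_smul_sub_det, ← hs, ha, g.2, algebraMap_smul]
        simp [sub_eq_neg_add]
      let B' : Subalgebra R (Matrix (Fin 2) (Fin 2) ℂ) :=
        { carrier := {x | ∃ b ∈ B, ∃ c ∈ B, x = b + c * a}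
          mul_mem' := by
            rintro _ _ ⟨b, hb, c, hc, rfl⟩ ⟨b', hb', c', hc', rfl⟩
            obtain ⟨d₁, hd₁, d₂, hd₂, hd⟩ := hcomm b' hb'
            obtain ⟨e₁, he₁, e₂, he₂, he⟩ := hcomm c' hc'
            obtain ⟨f₁, hf₁, f₂, hf₂, hf⟩ := hsq
            refine ⟨b * b' + c * d₁ + c * e₂ * f₁, ?_, b * c' + c * d₂ + c * e₁ + c * e₂ * f₂,
              ?_, ?_⟩
            · exact add_mem (add_mem (mul_mem hb hb') (mul_mem hc hd₁))
                (mul_mem (mul_mem hc he₂) hf₁)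
            · exact add_mem (add_mem (add_mem (mul_mem hb hc') (mul_mem hc hd₂)) (mul_mem hc he₁))
                (mul_mem (mul_mem hc he₂) hf₂)
            · have e1 : (b + c * a) * (b' + c' * a) =
                  b * b' + b * c' * a + c * (a * b') + c * (a * c') * a := by noncomm_ring
              have e2 : c * (e₁ + e₂ * a) * a = c * e₁ * a + c * e₂ * (a * a) := by noncomm_ring
              rw [e1, hd, he, e2, hf]
              noncomm_ring
          add_mem' := by
            rintro _ _ ⟨b, hb, c, hc, rfl⟩ ⟨b', hb', c', hc', rfl⟩
            exact ⟨b + b', add_mem hb hb', c + c', add_mem hc hc', by noncomm_ring⟩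
          algebraMap_mem' := fun r => ⟨algebraMap R _ r, B.algebraMap_mem r, 0, zero_mem _,
            by simp⟩ }
      have hB' : ∀ x, x ∈ B' ↔ ∃ b ∈ B, ∃ c ∈ B, x = b + c * a := fun x => Iff.rfl
      refine ⟨B', ?_, ?_, ?_, ?_⟩
      · rintro _ ⟨b, hb, c, hc, rfl⟩
        exact add_mem (hBO hb) (mul_mem (hBO hc) hgO)
      · have : Subalgebra.toSubmodule B' = Subalgebra.toSubmodule B ⊔
            (Subalgebra.toSubmodule B).map (LinearMap.mulRight R a) := by
          ext x
          rw [Subalgebra.mem_toSubmodule, hB', Submodule.mem_sup]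
          constructor
          · rintro ⟨b, hb, c, hc, rfl⟩
            exact ⟨b, hb, c * a, ⟨c, hc, rfl⟩, rfl⟩
          · rintro ⟨b, hb, _, ⟨c, hc, rfl⟩, rfl⟩
            exact ⟨b, hb, c, hc, rfl⟩
        rw [this]
        exact hBfg.sup (hBfg.map _)
      · intro x hx
        obtain ⟨t, ht⟩ : ∃ t : R, algebraMap R ℂ t = x.trace := by
          obtain ⟨b, hb, c, hc, rfl⟩ := hx
          exact exists_trace_eq htr (add_mem (hBO hb) (mul_mem (hBO hc) hgO))
        rw [adjugate_eq_trace_smul_sub, ← ht, algebraMap_smul]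
        exact sub_mem (B'.smul_mem (one_mem _) t) hx
      · intro h hh
        rcases Finset.mem_insert.1 hh with rfl | hh
        · exact ⟨0, zero_mem _, 1, one_mem _, by simp [ha]⟩
        · exact ⟨h.1, hBT h hh, 0, zero_mem _, by simp⟩
  obtain ⟨B, hBO, hBfg, hBadj, hBF⟩ := key F (Finset.Subset.refl F)
  have hSB : ∀ g ∈ S, g.1 ∈ B := by
    intro g hg
    rw [← hF] at hg
    induction hg using Subgroup.closure_induction with
    | mem g hg => exact hBF g hg
    | one => exact one_mem B
    | mul g h _ _ ihg ihh => exact mul_mem ihg ihh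
    | inv g _ ih =>
      rw [Matrix.SpecialLinearGroup.coe_inv]
      exact hBadj _ ih
  have : matOrder R S = B := by
    refine le_antisymm (Algebra.adjoin_le ?_) hBO
    rintro _ ⟨g, hg, rfl⟩
    exact hSB g hg
  rw [this]
  exact hBfg

variable (R S) in
/-- The inclusion of the group into its matrix order. -/
def toMatOrder : S →* matOrder R S where
  toFun g := ⟨g.1.1, mem_matOrder g.2⟩
  map_one' := rfl
  map_mul' _ _ := rfl

theorem toMatOrder_sq (g : S) {t : R} (ht : algebraMap R ℂ t = g.1.1.trace) :
    toMatOrder R S g ^ 2 = algebraMap R (matOrder R S) t * toMatOrder R S g - 1 := by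
  apply Subtype.ext
  change g.1.1 ^ 2 = algebraMap R (Matrix (Fin 2) (Fin 2) ℂ) t * g.1.1 - 1
  rw [sq_eq_trace_smul_sub_det, ← ht, g.1.2, one_smul, algebraMap_smul, Algebra.smul_def]

end Order
end HypMfd
end

noncomputable section
namespace HypMfd
open scoped TensorProduct
open Matrix IsLocalRing

/-! ### The residue field of the order -/

section Residue

theorem finite_quotient_smul_top {R : Type*} [CommRing R] [Algebra R ℂ] {S : Subgroup SL2C} (hS : S.FG)
    (htr : ∀ g ∈ S, ∃ t : R, algebraMap R ℂ t = g.1.trace) (I : Ideal R) [Finite (R ⧸ I)] :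
    Finite (matOrder R S ⧸ (I • ⊤ : Submodule R (matOrder R S))) := by
  have : Module.Finite R (matOrder R S) := Module.Finite.of_fg (matOrder_fg htr hS)
  exact Submodule.finite_quotient_smul I Module.Finite.fg_top

variable {R : Type*} [CommRing R] [IsLocalRing R] [Algebra R ℂ] {S : Subgroup SL2C}

/-- The elements of the order whose determinant is not a unit, as an ideal. It is assumed that
such elements do not have unit trace. -/
def detIdeal (htr : ∀ g ∈ S, ∃ t : R, algebraMap R ℂ t = g.1.trace)
    (hloc : ∀ x ∈ matOrder R S, ∀ t d : R, algebraMap R ℂ t = x.trace →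
      algebraMap R ℂ d = x.det → d ∈ maximalIdeal R → t ∈ maximalIdeal R) :
    Ideal (matOrder R S) where
  carrier := {x | ∃ d ∈ maximalIdeal R, algebraMap R ℂ d = x.1.det}
  zero_mem' := ⟨0, zero_mem _, by simp⟩
  add_mem' := by
    rintro ⟨x, hx⟩ ⟨y, hy⟩ ⟨d, hd, hdx⟩ ⟨e, he, hey⟩
    have hw := mul_mem hx (adjugate_mem_matOrder htr hy)
    obtain ⟨t, ht⟩ := exists_trace_eq htr hw
    -- The cross term of `det (x + y)` is the trace of `x * y.adjugate`, whose determinant is a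
    -- non-unit; `hloc` makes that trace a non-unit as well.
    have htm := hloc _ hw t (d * e) ht (by
      simp only at hdx hey
      rw [map_mul, hdx, hey, Matrix.det_mul, Matrix.det_adjugate]
      simp) (Ideal.mul_mem_right e _ hd)
    refine ⟨d + e + t, add_mem (add_mem hd he) htm, ?_⟩
    rw [map_add, map_add, hdx, hey, ht]
    exact (det_add_fin_two x y).symm
  smul_mem' := by
    rintro ⟨x, hx⟩ ⟨y, hy⟩ ⟨e, he, hey⟩
    obtain ⟨d, hd⟩ := exists_det_eq htr hx
    refine ⟨d * e, Ideal.mul_mem_left _ d he, ?_⟩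
    rw [map_mul, hd, hey]
    exact (Matrix.det_mul x y).symm

variable {htr : ∀ g ∈ S, ∃ t : R, algebraMap R ℂ t = g.1.trace}
    {hloc : ∀ x ∈ matOrder R S, ∀ t d : R, algebraMap R ℂ t = x.trace →
      algebraMap R ℂ d = x.det → d ∈ maximalIdeal R → t ∈ maximalIdeal R}

instance : (detIdeal htr hloc).IsTwoSided := ⟨by
  rintro ⟨x, hx⟩ ⟨y, hy⟩ ⟨e, he, hey⟩
  obtain ⟨d, hd⟩ := exists_det_eq htr hy
  refine ⟨e * d, Ideal.mul_mem_right _ _ he, ?_⟩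
  rw [map_mul, hd, hey]
  exact (Matrix.det_mul x y).symm⟩

theorem algebraMap_mem_detIdeal {r : R} (hr : r ∈ maximalIdeal R) :
    algebraMap R (matOrder R S) r ∈ detIdeal htr hloc := by
  refine ⟨r ^ 2, Ideal.pow_mem_of_mem _ hr 2 two_pos, ?_⟩
  change _ = (algebraMap R (Matrix (Fin 2) (Fin 2) ℂ) r).det
  rw [Algebra.algebraMap_eq_smul_one (A := Matrix (Fin 2) (Fin 2) ℂ), ← algebraMap_smul ℂ r,
    Matrix.det_smul]
  simp

theorem detIdeal_isDomain (hinj : Function.Injective (algebraMap R ℂ)) :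
    IsDomain (matOrder R S ⧸ detIdeal htr hloc) := by
  have hnt : Nontrivial (matOrder R S ⧸ detIdeal htr hloc) := by
    refine ⟨0, 1, fun h => ?_⟩
    obtain ⟨d, hd, hd1⟩ : (1 : matOrder R S) ∈ detIdeal htr hloc :=
      Ideal.Quotient.eq_zero_iff_mem.1 h.symm
    have : d = 1 := hinj (by rw [hd1, map_one]; exact Matrix.det_one)
    exact (Ideal.ne_top_iff_one _).1 (maximalIdeal.isMaximal R).ne_top (this ▸ hd)
  have hnz : NoZeroDivisors (matOrder R S ⧸ detIdeal htr hloc) := by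
    refine ⟨fun {a b} hab => ?_⟩
    obtain ⟨⟨x, hx⟩, rfl⟩ := Ideal.Quotient.mk_surjective a
    obtain ⟨⟨y, hy⟩, rfl⟩ := Ideal.Quotient.mk_surjective b
    rw [← map_mul, Ideal.Quotient.eq_zero_iff_mem] at hab
    obtain ⟨c, hc, hcxy⟩ := hab
    obtain ⟨d, hd⟩ := exists_det_eq htr hx
    obtain ⟨e, he⟩ := exists_det_eq htr hy
    have : c = d * e := hinj (by
      rw [hcxy, map_mul, hd, he]; exact Matrix.det_mul x y)
    rw [this] at hc
    rw [Ideal.Quotient.eq_zero_iff_mem, Ideal.Quotient.eq_zero_iff_mem]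
    exact ((maximalIdeal.isMaximal R).isPrime.mem_or_mem hc).imp (fun h => ⟨d, h, hd⟩)
      (fun h => ⟨e, h, he⟩)
  exact NoZeroDivisors.to_isDomain _

theorem finite_quotient_detIdeal (hS : S.FG) [Finite (ResidueField R)] :
    Finite (matOrder R S ⧸ detIdeal htr hloc) := by
  have : Finite (R ⧸ maximalIdeal R) := ‹Finite (ResidueField R)›
  have h1 := finite_quotient_smul_top hS htr (maximalIdeal R)
  have hle : ∀ x ∈ (maximalIdeal R • ⊤ : Submodule R (matOrder R S)),
      x ∈ detIdeal htr hloc := by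
    intro x hx
    induction hx using Submodule.smul_induction_on' with
    | smul r hr x _ =>
      rw [Algebra.smul_def]
      exact Ideal.mul_mem_right _ _ (algebraMap_mem_detIdeal hr)
    | add x _ y _ hx hy => exact add_mem hx hy
  let f : (matOrder R S ⧸ (maximalIdeal R • ⊤ : Submodule R (matOrder R S))) →
      matOrder R S ⧸ detIdeal htr hloc :=
    Quotient.lift (fun x => Ideal.Quotient.mk _ x) fun x y hxy => by
      rw [Ideal.Quotient.eq]
      exact hle _ ((Submodule.quotientRel_def _).1 hxy)
  refine Finite.of_surjective f fun y => ?_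
  obtain ⟨x, rfl⟩ := Ideal.Quotient.mk_surjective y
  exact ⟨Submodule.Quotient.mk x, rfl⟩

/-- The `Nat.card k`-power Frobenius fixes the image of `k`, so it sends `x` to `x` or to the
conjugate root `t - x`; its square fixes `x` in either case. -/
theorem pow_card_sq_eq {k F : Type*} [Field k] [Finite k] [CommRing F] [IsDomain F] [Algebra k F]
    {p n : ℕ} (hp : p.Prime) (hcard : Nat.card k = p ^ n) {x : F} {t d : k}
    (hx : x ^ 2 = algebraMap k F t * x - algebraMap k F d) : x ^ p ^ (2 * n) = x := by
  have := Fact.mk hp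
  have hpk : (p : k) = 0 := by
    have h : ((Nat.card k : ℕ) : k) = 0 := by
      have := Fintype.ofFinite k
      rw [Nat.card_eq_fintype_card]
      exact Nat.cast_card_eq_zero k
    rw [hcard, Nat.cast_pow] at h
    exact eq_zero_of_pow_eq_zero h
  have hchar : CharP F p := (CharP.charP_iff_prime_eq_zero hp).2 (by
    rw [← map_natCast (algebraMap k F), hpk, map_zero])
  have hfix : ∀ a : k, iterateFrobenius F p n (algebraMap k F a) = algebraMap k F a := by
    intro a
    rw [iterateFrobenius_def, ← map_pow, ← hcard]
    have := Fintype.ofFinite k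
    rw [Nat.card_eq_fintype_card, FiniteField.pow_card]
  set σ := iterateFrobenius F p n
  have h1 := congrArg σ hx
  rw [map_pow, map_sub, map_mul, hfix, hfix] at h1
  have h2 : (σ x - x) * (σ x - (algebraMap k F t - x)) = 0 := by
    linear_combination h1 - hx
  have h3 : σ (σ x) = x := by
    rcases mul_eq_zero.1 h2 with h | h
    · have := sub_eq_zero.1 h
      rw [this, this]
    · have h4 := sub_eq_zero.1 h
      rw [h4, map_sub, hfix, h4]
      ring
  rw [two_mul, pow_add, pow_mul, ← iterateFrobenius_def, ← iterateFrobenius_def]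
  exact h3

/-- A homomorphism to a finite division ring of degree at most two over a field of order `q`, all of
whose values have an `h`-th power in `± 1` times the image of the commutator subgroup, takes values
in `± 1` if `h` is coprime to `q ^ 2 - 1`. -/
theorem eq_one_or_eq_neg_one {G k F : Type*} [Group G] [Field k] [Finite k] [Ring F] [IsDomain F]
    [Finite F] (f : k →+* F) (ι : G →* F) {p n h : ℕ} (hp : p.Prime) (hcard : Nat.card k = p ^ n)
    (hh : Nat.Coprime h (p ^ (2 * n) - 1)) (hquad : ∀ a, ∃ t, ι a ^ 2 = f t * ι a - 1)
    (hcomm : ∀ a, ∃ c ∈ commutator G, ι a ^ h = ι c ∨ ι a ^ h = -ι c) (a : G) :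
    ι a = 1 ∨ ι a = -1 := by
  -- Wedderburn: the finite domain is commutative, so commutators of `G` map to `1`.
  have hfield := Finite.isDomain_to_isField F
  let _ : CommRing F := { (inferInstance : Ring F) with mul_comm := hfield.mul_comm }
  have hcom : ∀ c ∈ commutator G, ι c = 1 := fun c hc =>
    congrArg Units.val (MonoidHom.mem_ker.1
      (Abelianization.commutator_subset_ker ι.toHomUnits hc))
  have hpow : ι a ^ h = 1 ∨ ι a ^ h = -1 := by
    obtain ⟨c, hc, hgc⟩ := hcomm a
    rwa [hcom c hc] at hgc
  have hq : ι a ^ p ^ (2 * n) = ι a := by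
    let _ : Algebra k F := f.toAlgebra
    obtain ⟨t, ht⟩ := hquad a
    refine pow_card_sq_eq (k := k) (t := t) (d := 1) hp hcard ?_
    rw [map_one]
    exact ht
  have hu : IsUnit (ι a) := (Group.isUnit a).map ι
  have hq1 : ι a ^ (p ^ (2 * n) - 1) = 1 := by
    apply hu.mul_right_cancel
    rw [← pow_succ, Nat.sub_add_cancel (Nat.one_le_pow _ _ hp.pos), hq, one_mul]
  have hsq : (ι a ^ 2) = 1 := by
    have e1 : (ι a ^ 2) ^ h = 1 := by
      rw [← pow_mul, mul_comm, pow_mul]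
      rcases hpow with h | h <;> rw [h] <;> norm_num
    have e2 : (ι a ^ 2) ^ (p ^ (2 * n) - 1) = 1 := by
      rw [← pow_mul, mul_comm, pow_mul, hq1, one_pow]
    have := pow_gcd_eq_one.2 ⟨e1, e2⟩
    rwa [hh, pow_one] at this
  have : (ι a - 1) * (ι a + 1) = 0 := by linear_combination hsq
  rcases mul_eq_zero.1 this with h | h
  · exact Or.inl (sub_eq_zero.1 h)
  · exact Or.inr (eq_neg_of_add_eq_zero_left h)

/-- If the abelianization of `S / {± 1}` has no elements of order dividing `q ^ 2 - 1`, where `q` is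
the order of the residue field of `R`, then `S` is congruent to `± 1` modulo `detIdeal`. -/
theorem sub_one_or_add_one_mem_detIdeal (hinj : Function.Injective (algebraMap R ℂ)) (hS : S.FG)
    [Finite (ResidueField R)] {p n h : ℕ} (hp : p.Prime) (hcard : Nat.card (ResidueField R) = p ^ n)
    (hh : Nat.Coprime h (p ^ (2 * n) - 1))
    (hcomm : ∀ g : S, ∃ c ∈ commutator S, g.1 ^ h = c.1 ∨ g.1 ^ h = -c.1) (g : S) :
    toMatOrder R S g - 1 ∈ detIdeal htr hloc ∨ toMatOrder R S g + 1 ∈ detIdeal htr hloc := by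
  have hdom := detIdeal_isDomain (htr := htr) (hloc := hloc) hinj
  have hfin := finite_quotient_detIdeal (htr := htr) (hloc := hloc) hS
  let π : matOrder R S →+* matOrder R S ⧸ detIdeal htr hloc := Ideal.Quotient.mk _
  let f : ResidueField R →+* matOrder R S ⧸ detIdeal htr hloc :=
    Ideal.Quotient.lift _ (π.comp (algebraMap R (matOrder R S)))
      fun r hr => Ideal.Quotient.eq_zero_iff_mem.2 (algebraMap_mem_detIdeal hr)
  have key := eq_one_or_eq_neg_one f (π.toMonoidHom.comp (toMatOrder R S)) hp hcard hh ?_ ?_ g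
  · rcases key with h | h
    · left
      rw [← Ideal.Quotient.eq_zero_iff_mem, map_sub, map_one]
      exact sub_eq_zero.2 h
    · right
      rw [← Ideal.Quotient.eq_zero_iff_mem, map_add, map_one]
      exact add_eq_zero_iff_eq_neg.2 h
  · intro a
    obtain ⟨t, ht⟩ := htr a.1 a.2
    refine ⟨residue R t, ?_⟩
    change (π (toMatOrder R S a)) ^ 2 =
      π (algebraMap R (matOrder R S) t) * π (toMatOrder R S a) - 1
    rw [← map_pow, toMatOrder_sq a ht, map_sub, map_mul, map_one]
  · intro a
    obtain ⟨c, hc, hac⟩ := hcomm a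
    refine ⟨c, hc, hac.imp (fun h => ?_) (fun h => ?_)⟩
    · rw [← map_pow]
      congr 1
      exact Subtype.ext h
    · change π (toMatOrder R S a) ^ _ = -π (toMatOrder R S c)
      rw [← map_pow, ← map_neg, ← map_pow]
      congr 1
      exact Subtype.ext (congrArg (fun m : SL2C => m.1) h)

end Residue
end HypMfd
end

noncomputable section
namespace HypMfd
open scoped TensorProduct
open Matrix IsLocalRing

/-! ### Congruence subgroups -/

section Congruence

variable {R : Type*} [CommRing R] [Algebra R ℂ] {S : Subgroup SL2C}

variable (S) in
/-- The subgroup of the elements that are congruent to `1` modulo `a` in the matrix order. -/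
def congrSub (a : R) : Subgroup S where
  carrier := {g | ∃ z, toMatOrder R S g = 1 + a • z}
  one_mem' := ⟨0, by simp⟩
  mul_mem' := by
    rintro g h ⟨z, hz⟩ ⟨w, hw⟩
    refine ⟨z + w + a • (z * w), ?_⟩
    rw [map_mul, hz, hw, add_mul, mul_add, mul_add, smul_mul_smul_comm, smul_add, smul_add,
      smul_smul, one_mul, one_mul, mul_one]
    abel
  inv_mem' := by
    rintro g ⟨z, hz⟩
    refine ⟨-(toMatOrder R S g⁻¹ * z), ?_⟩
    have h1 : toMatOrder R S g⁻¹ * toMatOrder R S g = 1 := by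
      rw [← map_mul, inv_mul_cancel, map_one]
    rw [hz, mul_add, mul_one, mul_smul_comm] at h1
    rw [smul_neg, ← sub_eq_add_neg, eq_sub_iff_add_eq, h1]

instance congrSub_normal (a : R) : (congrSub S a).Normal := by
  refine ⟨?_⟩
  rintro g ⟨z, hz⟩ h
  refine ⟨toMatOrder R S h * z * toMatOrder R S h⁻¹, ?_⟩
  rw [map_mul, map_mul, hz, mul_add, add_mul, mul_one, ← map_mul, mul_inv_cancel, map_one,
    mul_smul_comm, smul_mul_assoc]

theorem congrSub_finiteIndex (htr : ∀ g ∈ S, ∃ t : R, algebraMap R ℂ t = g.1.trace) (hS : S.FG)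
    (a : R) [Finite (R ⧸ Ideal.span {a})] : (congrSub S a).FiniteIndex := by
  have h1 := finite_quotient_smul_top hS htr (Ideal.span {a})
  have hmem : ∀ x, x ∈ (Ideal.span {a} • ⊤ : Submodule R (matOrder R S)) → ∃ z, x = a • z := by
    intro x hx
    rw [Submodule.ideal_span_singleton_smul] at hx
    obtain ⟨z, -, rfl⟩ := hx
    exact ⟨z, rfl⟩
  let f : S ⧸ congrSub S a →
      matOrder R S ⧸ (Ideal.span {a} • ⊤ : Submodule R (matOrder R S)) :=
    fun x => Submodule.Quotient.mk (toMatOrder R S x.out)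
  have hf : Function.Injective f := by
    intro x y hxy
    obtain ⟨z, hz⟩ := hmem _ ((Submodule.Quotient.eq _).1 hxy)
    rw [← QuotientGroup.out_eq' x, ← QuotientGroup.out_eq' y, eq_comm, QuotientGroup.eq]
    refine ⟨toMatOrder R S y.out⁻¹ * z, ?_⟩
    rw [← mul_smul_comm, ← hz, mul_sub, ← map_mul, ← map_mul, inv_mul_cancel, map_one]
    abel
  have := Finite.of_injective f hf
  exact Subgroup.finiteIndex_of_finite_quotient

/-- In the expansion of `(1 + b • z) ^ p` the linear term gains the factor `a` from `p`, and all
higher terms gain it from the square. -/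
theorem pow_mem_congrSub_of_sq {p : ℕ} {a b : R} (hp : ∃ c, (p : R) = a * c) {g : S}
    (hg : ∃ z, toMatOrder R S g = 1 + b • z ∧ ∃ w, (b • z) ^ 2 = (b * a) • w) : g ^ p ∈ congrSub S (b * a) := by
  obtain ⟨z, hz, w, hw⟩ := hg
  obtain ⟨κ, hκ⟩ := exists_one_add_pow_eq (b • z) p
  obtain ⟨c, hc⟩ := hp
  refine ⟨c • z + (p.choose 2) • w + w * (b • z * κ), ?_⟩
  have e3 : (b • z) ^ 3 * κ = (b * a) • (w * (b • z * κ)) := by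
    rw [pow_succ, hw, mul_assoc, smul_mul_assoc]
  have e1 : (p : matOrder R S) * (b • z) = (b * a) • (c • z) := by
    rw [← map_natCast (algebraMap R (matOrder R S)), hc, ← Algebra.smul_def, smul_smul, smul_smul]
    congr 1
    ring
  rw [map_pow, hz, hκ, e1, e3, hw, smul_add, smul_add, ← nsmul_eq_mul, smul_comm (p.choose 2)]
  abel

/-- The hypothesis says only that `g - 1` is nilpotent modulo `ϖ`, so the first `p`-th power is
needed to reach the first congruence subgroup; each further one gains a factor `ϖ`. -/
theorem pow_pow_mem_congrSub {p : ℕ} {ϖ : R} (hp : ∃ c, (p : R) = ϖ * c) {g : S}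
    (hg : ∃ w, (toMatOrder R S g - 1) ^ 2 = ϖ • w) (i : ℕ) :
    g ^ p ^ (i + 1) ∈ congrSub S (ϖ ^ (i + 1)) := by
  induction i with
  | zero =>
    rw [zero_add, pow_one, pow_one]
    have := pow_mem_congrSub_of_sq (b := 1) hp (g := g)
      ⟨toMatOrder R S g - 1, by rw [one_smul]; abel, by simpa using hg⟩
    rwa [one_mul] at this
  | succ i ih =>
    obtain ⟨z, hz⟩ := ih
    rw [pow_succ p, pow_mul, pow_succ ϖ (i + 1)]
    refine pow_mem_congrSub_of_sq hp ⟨z, hz, ϖ ^ i • z ^ 2, ?_⟩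
    rw [smul_pow, smul_smul]
    congr 1
    ring

end Congruence

/-! ### The congruence tower at a ramified prime -/

section Tower

open scoped commutatorElement

theorem eq_or_eq_neg_of_mk_eq {g h : SL2C}
    (hgh : (QuotientGroup.mk' (Subgroup.center SL2C)) g = QuotientGroup.mk' _ h) :
    h = g ∨ h = -g := by
  have hc : g⁻¹ * h ∈ Subgroup.center SL2C := QuotientGroup.eq.1 hgh
  obtain ⟨r, hr, hrg⟩ := Matrix.SpecialLinearGroup.mem_center_iff.1 hc
  simp only [Fintype.card_fin] at hr
  have hh : h = g * (g⁻¹ * h) := by group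
  rcases sq_eq_sq_iff_eq_or_eq_neg.1 (hr.trans (one_pow 2).symm) with h1 | h1
  · left
    have : g⁻¹ * h = 1 := Subtype.ext (by rw [← hrg, h1]; simp)
    rw [hh, this, mul_one]
  · right
    have : g⁻¹ * h = -1 := Subtype.ext (by rw [← hrg, h1, map_neg, map_one]; rfl)
    rw [hh, this, mul_neg, mul_one]

theorem mk_neg_eq (g : SL2C) : (QuotientGroup.mk' (Subgroup.center SL2C)) (-g) =
    QuotientGroup.mk' _ g := by
  refine QuotientGroup.eq.2 ?_
  refine Matrix.SpecialLinearGroup.mem_center_iff.2 ⟨-1, by simp, ?_⟩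
  rw [show (-g)⁻¹ * g = -1 by rw [inv_neg, neg_mul, inv_mul_cancel], map_neg, map_one]
  rfl

/-- The projection of the preimage of `Γ` in `SL(2, ℂ)` to `Γ`. -/
def liftProj (Γ : Subgroup PSL2C) : lift Γ →* Γ where
  toFun g := ⟨QuotientGroup.mk' (Subgroup.center SL2C) g.1, g.2⟩
  map_one' := rfl
  map_mul' _ _ := rfl

theorem liftProj_surjective (Γ : Subgroup PSL2C) : Function.Surjective (liftProj Γ) := by
  rintro ⟨g, hg⟩
  obtain ⟨h, rfl⟩ := QuotientGroup.mk'_surjective _ g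
  exact ⟨⟨h, hg⟩, rfl⟩

theorem neg_mem_lift {Γ : Subgroup PSL2C} {g : SL2C} (hg : g ∈ lift Γ) : -g ∈ lift Γ := by
  rw [lift, Subgroup.mem_comap, mk_neg_eq]
  exact hg

theorem lift_fg {Γ : Subgroup PSL2C} (hΓ : Γ.FG) : (lift Γ).FG := by
  classical
  obtain ⟨F, hF⟩ := hΓ
  have hsurj := QuotientGroup.mk'_surjective (Subgroup.center SL2C)
  choose s hs using hsurj
  refine ⟨insert (-1) (F.image s), le_antisymm ?_ ?_⟩
  · rw [Subgroup.closure_le]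
    intro x hx
    rcases Finset.mem_insert.1 hx with rfl | hx
    · exact neg_mem_lift (one_mem _)
    · obtain ⟨y, hy, rfl⟩ := Finset.mem_image.1 hx
      change QuotientGroup.mk' _ (s y) ∈ Γ
      rw [hs, ← hF]
      exact Subgroup.subset_closure hy
  · intro g hg
    set H := Subgroup.closure ((insert (-1) (F.image s) : Finset SL2C) : Set SL2C) with hH
    have hneg : (-1 : SL2C) ∈ H := Subgroup.subset_closure (by simp)
    have hle : Γ ≤ H.map (QuotientGroup.mk' (Subgroup.center SL2C)) := by
      rw [← hF, Subgroup.closure_le]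
      intro y hy
      exact ⟨s y, Subgroup.subset_closure (by
        rw [Finset.coe_insert, Finset.coe_image]
        exact Or.inr ⟨y, hy, rfl⟩), hs y⟩
    obtain ⟨h, hh, hgh⟩ := hle hg
    rcases eq_or_eq_neg_of_mk_eq hgh with rfl | rfl
    · exact hh
    · rw [← mul_one h, ← mul_neg]
      exact mul_mem hh hneg

theorem matOrder_le_quatAlg {Γ : Subgroup PSL2C} (V : ValuationSubring (traceField Γ))
    {x : Matrix (Fin 2) (Fin 2) ℂ} (hx : x ∈ matOrder V (lift Γ)) : x ∈ quatAlg Γ := by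
  refine matOrder_induction (R := V) (S := lift Γ) (P := fun x => x ∈ quatAlg Γ) ?_ ?_ hx
  · intro r g hg
    exact (quatAlg Γ).smul_mem (Algebra.subset_adjoin ⟨g, hg, rfl⟩) (r : traceField Γ)
  · intro x _ y _ hx hy
    exact add_mem hx hy

/-- The tower of congruence subgroups at a ramified prime of the quaternion algebra. -/
theorem exists_congruence_tower {Γ : Subgroup PSL2C} (hΓ : Γ.FG) {p n h : ℕ} (hp : p.Prime)
    (hram : RamifiesAtPrimeOfNorm Γ (p ^ n)) (hh : Nat.Coprime h (p ^ (2 * n) - 1))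
    (hcomm : ∀ g : Γ, g ^ h ∈ commutator Γ) :
    ∃ Λ : ℕ → Subgroup Γ, Λ 0 = ⊤ ∧ Antitone Λ ∧ (∀ i, (Λ i).Normal) ∧
      (∀ i, (Λ i).FiniteIndex) ∧ (∀ i, ∀ g : Γ, ∃ e, g ^ p ^ e ∈ Λ i) ∧
      ∀ g, (∀ i, g ∈ Λ i) → g = 1 := by
  obtain ⟨V, hV, hcard, hD⟩ := hram
  set S := lift Γ with hS
  have hSfg : S.FG := lift_fg hΓ
  have hinj : Function.Injective (algebraMap V ℂ) :=
    (algebraMap (traceField Γ) ℂ).injective.comp Subtype.val_injective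
  have hmem_lt : ∀ x : V, x ∈ maximalIdeal V ↔ V.valuation (x : traceField Γ) < 1 := fun x =>
    V.valuation_lt_one_iff x
  have hSA : ∀ g ∈ S, g.1 ∈ quatAlg Γ := fun g hg => Algebra.subset_adjoin ⟨g, hg, rfl⟩
  -- Integrality of traces: the determinant is `1`, so a trace of value above one would make `1 / t
  -- ^ 2` small.
  have htr : ∀ g ∈ S, ∃ t : V, algebraMap V ℂ t = g.1.trace := by
    intro g hg
    have ht : g.1.trace ∈ traceField Γ := IntermediateField.subset_adjoin _ _ ⟨g, hg, rfl⟩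
    let t : traceField Γ := ⟨g.1.trace, ht⟩
    suffices htV : t ∈ V from ⟨⟨t, htV⟩, rfl⟩
    by_cases ht0 : t = 0
    · rw [ht0]; exact zero_mem V
    have := not_valuation_det_div_trace_sq_lt_one hD (hSA g hg) (t := t) (d := 1) rfl
      (by rw [map_one, g.2]) ht0
    by_contra hnot
    apply this
    have h1 : 1 < V.valuation t := by
      by_contra h
      exact hnot (V.mem_of_valuation_le_one _ (not_lt.1 h))
    rw [map_div₀, map_one, map_pow, div_lt_one₀ (by
      exact pow_pos (lt_trans zero_lt_one h1) 2)]
    exact one_lt_pow₀ h1 two_ne_zero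
  have hloc : ∀ x ∈ matOrder V S, ∀ t d : V, algebraMap V ℂ t = x.trace →
      algebraMap V ℂ d = x.det → d ∈ maximalIdeal V → t ∈ maximalIdeal V := by
    intro x hx t d ht hd hdm
    by_contra htm
    have hV1 : V.valuation (t : traceField Γ) = 1 := by
      refine le_antisymm (V.valuation_le_one t) (not_lt.1 fun h => htm ((hmem_lt t).2 h))
    have ht0 : (t : traceField Γ) ≠ 0 := by
      intro h
      rw [h, map_zero] at hV1
      exact zero_ne_one hV1
    refine not_valuation_det_div_trace_sq_lt_one hD (matOrder_le_quatAlg V hx)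
      (t := t) (d := d) ht hd ht0 ?_
    rw [map_div₀, map_pow, hV1, one_pow, div_one]
    exact (hmem_lt d).1 hdm
  have hfin : Finite (ResidueField V) := by
    apply Nat.finite_of_card_ne_zero
    rw [hcard]
    exact pow_ne_zero _ hp.ne_zero
  have hpm : (p : V) ∈ maximalIdeal V := by
    rw [← residue_eq_zero_iff, map_natCast]
    have h0 : ((Nat.card (ResidueField V) : ℕ) : ResidueField V) = 0 := by
      have := Fintype.ofFinite (ResidueField V)
      rw [Nat.card_eq_fintype_card]
      exact Nat.cast_card_eq_zero _
    rw [hcard, Nat.cast_pow] at h0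
    exact eq_zero_of_pow_eq_zero h0
  obtain ⟨ϖ, hϖ⟩ := IsDiscreteValuationRing.exists_irreducible V
  have hdvd : ∀ x ∈ maximalIdeal V, ∃ c, x = ϖ * c := by
    intro x hx
    rw [hϖ.maximalIdeal_eq, Ideal.mem_span_singleton] at hx
    exact hx
  have hcomm' : ∀ g : S, ∃ c ∈ commutator S, g.1 ^ h = c.1 ∨ g.1 ^ h = -c.1 := by
    intro g
    have h1 := hcomm (liftProj Γ g)
    have h2 : commutator Γ = (commutator S).map (liftProj Γ) := by
      rw [commutator_def, commutator_def, Subgroup.map_commutator,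
        Subgroup.map_top_of_surjective _ (liftProj_surjective Γ)]
    rw [h2, ← map_pow] at h1
    obtain ⟨c, hc, hcg⟩ := h1
    exact ⟨c, hc, eq_or_eq_neg_of_mk_eq (congrArg Subtype.val hcg)⟩
  have hcong := sub_one_or_add_one_mem_detIdeal (htr := htr) (hloc := hloc) hinj hSfg hp hcard hh
    hcomm'
  -- Of the two lifts `± s`, choose the one congruent to `1`; elements of `Γ` are only determined up
  -- to sign.
  have hlift : ∀ g : Γ, ∃ s : S, liftProj Γ s = g ∧ toMatOrder V S s - 1 ∈ detIdeal htr hloc := by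
    intro g
    obtain ⟨s, rfl⟩ := liftProj_surjective Γ g
    rcases hcong s with h | h
    · exact ⟨s, rfl, h⟩
    · refine ⟨⟨-s.1, neg_mem_lift s.2⟩, Subtype.ext (mk_neg_eq s.1), ?_⟩
      have h2 := neg_mem h
      convert! h2 using 1
      rw [neg_add']
      rfl
  refine ⟨fun i => (congrSub S (ϖ ^ i)).map (liftProj Γ), ?_, ?_, ?_, ?_, ?_, ?_⟩
  · rw [eq_top_iff]
    intro g _
    obtain ⟨s, rfl⟩ := liftProj_surjective Γ g
    exact ⟨s, ⟨toMatOrder V S s - 1, by rw [pow_zero, one_smul]; abel⟩, rfl⟩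
  · refine antitone_nat_of_succ_le fun i => Subgroup.map_mono ?_
    rintro g ⟨z, hz⟩
    exact ⟨ϖ • z, by rw [hz, smul_smul, pow_succ]⟩
  · exact fun i => Subgroup.Normal.map inferInstance _ (liftProj_surjective Γ)
  · intro i
    have : Finite (V ⧸ Ideal.span {ϖ ^ i}) := by
      rw [← Ideal.span_singleton_pow, ← hϖ.maximalIdeal_eq]
      have : Finite (V ⧸ maximalIdeal V) := hfin
      exact Ideal.finite_quotient_pow (IsNoetherian.noetherian _) i
    have hfi := congrSub_finiteIndex htr hSfg (ϖ ^ i)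
    have : (((congrSub S (ϖ ^ i)).map (liftProj Γ)).comap (liftProj Γ)).FiniteIndex :=
      Subgroup.finiteIndex_of_le (Subgroup.le_comap_map _ _)
    refine ⟨?_⟩
    rw [← Subgroup.index_comap_of_surjective _ (liftProj_surjective Γ)]
    exact this.index_ne_zero
  · intro i g
    obtain ⟨s, rfl, hs⟩ := hlift g
    obtain ⟨d, hd, hdx⟩ := hs
    set x := toMatOrder V S s - 1 with hx
    obtain ⟨t, ht⟩ := exists_trace_eq htr x.2
    obtain ⟨t', rfl⟩ := hdvd t (hloc _ x.2 t d ht hdx hd)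
    obtain ⟨d', rfl⟩ := hdvd d hd
    -- Cayley-Hamilton: trace and determinant of `x` are both divisible by `ϖ`.
    have hsq : ∃ w, x ^ 2 = ϖ • w := by
      refine ⟨t' • x - d' • 1, Subtype.ext ?_⟩
      change x.1 ^ 2 = ϖ • (t' • x.1 - d' • (1 : Matrix (Fin 2) (Fin 2) ℂ))
      rw [sq_eq_trace_smul_sub_det, ← ht, ← hdx, algebraMap_smul, algebraMap_smul, smul_sub,
        smul_smul, smul_smul]
    -- The power lies in level `i + 1`, one deeper than required; this also covers `i = 0`.
    refine ⟨i + 1, s ^ p ^ (i + 1), ?_, map_pow _ _ _⟩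
    obtain ⟨z, hz⟩ := pow_pow_mem_congrSub (hdvd _ hpm) hsq i
    exact ⟨ϖ • z, by rw [hz, smul_smul, pow_succ]⟩
  · intro g hg
    obtain ⟨s, rfl⟩ := liftProj_surjective Γ g
    obtain ⟨t, ht⟩ := htr s.1 s.2
    have hdet1 : ((1 : Matrix (Fin 2) (Fin 2) ℂ) - s.1.1).det = algebraMap V ℂ (2 - t) := by
      have h2 := s.1.2
      rw [Matrix.det_fin_two] at h2
      rw [map_sub, ht, Matrix.trace_fin_two, Matrix.det_fin_two, map_ofNat]
      simp
      linear_combination h2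
    have hdet2 : ((1 : Matrix (Fin 2) (Fin 2) ℂ) + s.1.1).det = algebraMap V ℂ (2 + t) := by
      have h2 := s.1.2
      rw [Matrix.det_fin_two] at h2
      rw [map_add, ht, Matrix.trace_fin_two, Matrix.det_fin_two, map_ofNat]
      simp
      linear_combination h2
    -- The lift congruent to `1` modulo `ϖ ^ i` is `s` or `-s`, and the sign may vary with `i`; the
    -- product of the determinants of `1 - s` and `1 + s` treats both cases at once.
    have hdvdi : ∀ i, ϖ ^ i ∣ (2 - t) * (2 + t) := by
      intro i
      obtain ⟨u, ⟨z, hz⟩, hu⟩ := hg i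
      obtain ⟨d, hd⟩ := exists_det_eq htr z.2
      have hu' : u.1.1 = 1 + ϖ ^ i • z.1 := congrArg Subtype.val hz
      have hdet : (u.1.1 - 1).det = algebraMap V ℂ (ϖ ^ i * (ϖ ^ i * d)) := by
        rw [hu', add_sub_cancel_left, ← algebraMap_smul ℂ (ϖ ^ i), Matrix.det_smul, ← hd]
        simp only [Fintype.card_fin, map_mul, map_pow]
        ring
      rcases eq_or_eq_neg_of_mk_eq (congrArg Subtype.val hu.symm) with h | h
      · have : 2 - t = ϖ ^ i * (ϖ ^ i * d) := hinj (by
          rw [← hdet, ← hdet1, h, ← neg_sub, Matrix.det_neg]; simp)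
        rw [this]
        exact Dvd.dvd.mul_right (Dvd.intro _ rfl) _
      · have : 2 + t = ϖ ^ i * (ϖ ^ i * d) := hinj (by
          rw [← hdet, ← hdet2, h]
          change _ = (-s.1.1 - 1).det
          rw [← neg_add', add_comm, Matrix.det_neg]; simp)
        rw [this]
        exact Dvd.dvd.mul_left (Dvd.intro _ rfl) _
    have hzero : (2 - t) * (2 + t) = 0 := by
      by_contra hne
      obtain ⟨m, u, hmu⟩ := IsDiscreteValuationRing.eq_unit_mul_pow_irreducible hne hϖ
      have := hdvdi (m + 1)
      rw [hmu, Units.dvd_mul_left, pow_dvd_pow_iff hϖ.ne_zero hϖ.not_isUnit] at this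
      omega
    have hone : (1 : Matrix (Fin 2) (Fin 2) ℂ) ∈ quatAlg Γ := one_mem _
    rcases mul_eq_zero.1 hzero with h0 | h0
    · have : (1 : Matrix (Fin 2) (Fin 2) ℂ) - s.1.1 = 0 :=
        eq_zero_of_det_eq_zero hD (sub_mem hone (hSA _ s.2)) (t := 2 - (t : traceField Γ)) (by
          rw [Matrix.trace_sub, ← ht, Matrix.trace_one, map_sub, map_ofNat]
          simp
          rfl) (by rw [hdet1, h0, map_zero])
      have hs1 : s.1 = 1 := Subtype.ext (sub_eq_zero.1 this).symm
      exact Subtype.ext (by change QuotientGroup.mk' _ s.1 = 1; rw [hs1, map_one])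
    · have : (1 : Matrix (Fin 2) (Fin 2) ℂ) + s.1.1 = 0 :=
        eq_zero_of_det_eq_zero hD (add_mem hone (hSA _ s.2)) (t := 2 + (t : traceField Γ)) (by
          rw [Matrix.trace_add, ← ht, Matrix.trace_one, map_add, map_ofNat]
          simp
          rfl) (by rw [hdet2, h0, map_zero])
      have hs1 : s.1 = -1 := Subtype.ext (eq_neg_of_add_eq_zero_right this)
      exact Subtype.ext (by change QuotientGroup.mk' _ s.1 = 1; rw [hs1, mk_neg_eq, map_one])

end Tower
end HypMfd
end

noncomputable section
namespace HypMfd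

/-! ### Singular simplices and covering maps -/

section Covering



/-- The `i`-th vertex of the standard simplex. -/
abbrev vtx {n : ℕ} (i : Fin (n + 1)) : stdSimplex ℝ (Fin (n + 1)) := stdSimplex.vertex i

theorem stdSimplex_map_const {m n : ℕ} (j : Fin (n + 1)) (x : stdSimplex ℝ (Fin (m + 1))) :
    stdSimplex.map (fun _ => j) x = vtx j := by
  ext k
  rw [stdSimplex.map_coe, FunOnFinite.linearMap_apply_apply, stdSimplex.vertex_coe]
  by_cases h : j = k
  · subst h
    simp
  · simp [h]

theorem face_vtx {X : Type} [TopologicalSpace X] {n : ℕ} (i : Fin (n + 2)) (σ : Simp X (n + 1))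
    (j : Fin (n + 1)) : face i σ (vtx j) = σ (vtx (i.succAbove j)) := by
  change σ (stdSimplex.map i.succAbove (vtx j)) = _
  rw [stdSimplex.map_vertex]

theorem simp_zero_ext {X : Type} [TopologicalSpace X] {σ τ : Simp X 0}
    (h : σ (vtx 0) = τ (vtx 0)) : σ = τ := by
  ext x
  rw [Subsingleton.elim x (vtx 0), h]

/-- The contraction of the standard simplex to its zeroth vertex. -/
def simplexContraction (n : ℕ) : C(unitInterval × stdSimplex ℝ (Fin (n + 1)), stdSimplex ℝ (Fin (n + 1))) where
  toFun x := ⟨(1 - (x.1 : ℝ)) • (vtx 0 : stdSimplex ℝ (Fin (n + 1))).1 + (x.1 : ℝ) • x.2.1,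
    convex_stdSimplex ℝ _ (vtx 0).2 x.2.2 (sub_nonneg.2 x.1.2.2) x.1.2.1 (by ring)⟩
  continuous_toFun := by
    refine Continuous.subtype_mk ?_ _
    fun_prop

theorem simplexContraction_zero {n : ℕ} (a : stdSimplex ℝ (Fin (n + 1))) :
    simplexContraction n (0, a) = vtx 0 := Subtype.ext (by simp [simplexContraction])

theorem simplexContraction_one {n : ℕ} (a : stdSimplex ℝ (Fin (n + 1))) :
    simplexContraction n (1, a) = a := Subtype.ext (by simp [simplexContraction])

variable {E X G : Type} [TopologicalSpace E] [TopologicalSpace X] [Group G] [MulAction G E]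
  {p : E → X}

/-- The simplex contracts to a vertex, so lifting a singular simplex is homotopy lifting from a
constant map. -/
theorem exists_lift_simp (hp : IsQuotientCoveringMap p G) {n : ℕ} (σ : Simp X n) :
    ∃ τ : Simp E n, ∀ a, p (τ a) = σ a := by
  obtain ⟨e, he⟩ := hp.surjective (σ (vtx 0))
  let H : C(unitInterval × stdSimplex ℝ (Fin (n + 1)), X) := σ.comp (simplexContraction n)
  have hH0 : ∀ a, H (0, a) = p (ContinuousMap.const _ e a) := by
    intro a
    change σ (simplexContraction n (0, a)) = p e
    rw [simplexContraction_zero, he]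
  let L := hp.isCoveringMap.liftHomotopy H (ContinuousMap.const _ e) hH0
  refine ⟨L.comp ⟨fun a => (1, a), by fun_prop⟩, fun a => ?_⟩
  have := congrFun (hp.isCoveringMap.liftHomotopy_lifts H (ContinuousMap.const _ e) hH0) (1, a)
  change p (L (1, a)) = _
  refine this.trans ?_
  change σ (simplexContraction n (1, a)) = σ a
  rw [simplexContraction_one]

/-- A deck element matches the two lifts at one vertex, and lifts on a connected domain that agree
at a point agree everywhere. -/
theorem lift_simp_unique (hp : IsQuotientCoveringMap p G) {n : ℕ} {τ τ' : Simp E n}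
    (h : ∀ a, p (τ a) = p (τ' a)) : ∃ g : G, ∀ a, τ a = g • τ' a := by
  have := hp.toContinuousConstSMul
  obtain ⟨g, hg⟩ := hp.apply_eq_iff_mem_orbit.1 (h (vtx 0))
  refine ⟨g, congrFun ?_⟩
  refine hp.isCoveringMap.eq_of_comp_eq τ.continuous (τ'.continuous.const_smul g) ?_ (vtx 0)
    hg.symm
  ext a
  exact (h a).trans (hp.map_smul g).symm

/-- A section of a quotient covering map. -/
def coverSection (hp : IsQuotientCoveringMap p G) : X → E := Function.surjInv hp.surjective

theorem apply_coverSection (hp : IsQuotientCoveringMap p G) (x : X) : p (coverSection hp x) = x :=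
  Function.surjInv_eq hp.surjective x

theorem exists_smul_coverSection (hp : IsQuotientCoveringMap p G) (e : E) :
    ∃ g : G, g • coverSection hp (p e) = e :=
  hp.apply_eq_iff_mem_orbit.1 (apply_coverSection hp (p e)).symm

/-- The element of the group that translates the chosen point of a fibre to a given one. -/
def deckElt (hp : IsQuotientCoveringMap p G) (e : E) : G := (exists_smul_coverSection hp e).choose

theorem deckElt_smul_coverSection (hp : IsQuotientCoveringMap p G) (e : E) :
    deckElt hp e • coverSection hp (p e) = e := (exists_smul_coverSection hp e).choose_spec

theorem deckElt_eq (hp : IsQuotientCoveringMap p G) {g : G} {e : E}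
    (h : g • coverSection hp (p e) = e) : deckElt hp e = g := by
  have := hp.isCancelSMul
  exact IsCancelSMul.right_cancel _ _ _ ((deckElt_smul_coverSection hp e).trans h.symm)

theorem deckElt_smul (hp : IsQuotientCoveringMap p G) (g : G) (e : E) :
    deckElt hp (g • e) = g * deckElt hp e := by
  apply deckElt_eq
  rw [hp.map_smul, mul_smul, deckElt_smul_coverSection]

/-- The cocycle on the singular `1`-simplices with values in the group of a quotient covering. -/
def deckCocycle (hp : IsQuotientCoveringMap p G) (σ : Simp X 1) : G :=
  (deckElt hp ((exists_lift_simp hp σ).choose (vtx 0)))⁻¹ *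
    deckElt hp ((exists_lift_simp hp σ).choose (vtx 1))

theorem deckCocycle_eq (hp : IsQuotientCoveringMap p G) {σ : Simp X 1} {τ : Simp E 1}
    (h : ∀ a, p (τ a) = σ a) :
    deckCocycle hp σ = (deckElt hp (τ (vtx 0)))⁻¹ * deckElt hp (τ (vtx 1)) := by
  obtain ⟨g, hg⟩ := lift_simp_unique hp
    (τ := (exists_lift_simp hp σ).choose) (τ' := τ) fun a => by
      rw [(exists_lift_simp hp σ).choose_spec, h]
  rw [deckCocycle, hg, hg, deckElt_smul, deckElt_smul]
  group

theorem deckCocycle_face (hp : IsQuotientCoveringMap p G) (σ : Simp X 2) :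
    deckCocycle hp (face 1 σ) = deckCocycle hp (face 2 σ) * deckCocycle hp (face 0 σ) := by
  obtain ⟨τ, hτ⟩ := exists_lift_simp hp σ
  have hf : ∀ i a, p (face i τ a) = face i σ a := fun i a => hτ _
  rw [deckCocycle_eq hp (hf 0), deckCocycle_eq hp (hf 1), deckCocycle_eq hp (hf 2)]
  simp only [face_vtx]
  have e1 : (1 : Fin 3).succAbove (0 : Fin 2) = 0 := rfl
  have e2 : (1 : Fin 3).succAbove (1 : Fin 2) = 2 := rfl
  have e3 : (2 : Fin 3).succAbove (0 : Fin 2) = 0 := rfl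
  have e4 : (2 : Fin 3).succAbove (1 : Fin 2) = 1 := rfl
  have e5 : (0 : Fin 3).succAbove (0 : Fin 2) = 1 := rfl
  have e6 : (0 : Fin 3).succAbove (1 : Fin 2) = 2 := rfl
  rw [e1, e2, e3, e4, e5, e6]
  group

/-- The singular `1`-simplex of a path. -/
def pathSimp {x y : E} (γ : Path x y) : Simp E 1 :=
  γ.toContinuousMap.comp ⟨stdSimplexHomeomorphUnitInterval, Homeomorph.continuous _⟩

theorem pathSimp_zero {x y : E} (γ : Path x y) : pathSimp γ (vtx 0) = x := γ.source

theorem pathSimp_one {x y : E} (γ : Path x y) : pathSimp γ (vtx 1) = y := γ.target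

/-- Every element of the group is the value of the cocycle on a loop. -/
theorem exists_loop_deckCocycle [PathConnectedSpace E] (hp : IsQuotientCoveringMap p G) (g : G) :
    ∃ σ : Simp X 1, face 0 σ = face 1 σ ∧ deckCocycle hp σ = g := by
  have : Nonempty E := inferInstance
  let x : X := p this.some
  let e := coverSection hp x
  let τ := pathSimp (PathConnectedSpace.somePath e (g • e))
  let σ : Simp X 1 := (⟨p, hp.continuous⟩ : C(E, X)).comp τ
  have h0 : τ (vtx 0) = e := pathSimp_zero _
  have h1 : τ (vtx 1) = g • e := pathSimp_one _
  have hd : deckElt hp e = 1 := deckElt_eq hp (by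
    rw [one_smul]
    exact congrArg (coverSection hp) (apply_coverSection hp x))
  refine ⟨σ, simp_zero_ext ?_, ?_⟩
  · rw [face_vtx, face_vtx]
    change p (τ (vtx 1)) = p (τ (vtx 0))
    rw [h0, h1, hp.map_smul]
  · rw [deckCocycle_eq hp (τ := τ) fun a => rfl, h0, h1, deckElt_smul, hd]
    group

/-! ### First homology and cohomology of the base of a quotient covering -/

theorem boundary_single {R : Type} [CommRing R] {n : ℕ} (σ : Simp X (n + 1)) :
    boundary R X n (Finsupp.single σ 1) =
      ∑ i : Fin (n + 2), (-1 : R) ^ (i : ℕ) • Finsupp.single (face i σ) 1 := by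
  simp [boundary]

/-- The order of the first homology group annihilates the abelianization of the group of a quotient
covering. -/
theorem pow_card_H1_mem_commutator [PathConnectedSpace E] (hp : IsQuotientCoveringMap p G) (g : G) :
    g ^ Nat.card (H1 X) ∈ commutator G := by
  let Φ : (Simp X 1 →₀ ℤ) →ₗ[ℤ] Additive (Abelianization G) :=
    Finsupp.lift _ ℤ _ fun σ => Additive.ofMul (Abelianization.of (deckCocycle hp σ))
  have hΦ : ∀ σ, Φ (Finsupp.single σ 1) = Additive.ofMul (Abelianization.of (deckCocycle hp σ)) := by
    intro σ
    simp [Φ]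
  have hΦb : ∀ c, Φ (boundary ℤ X 1 c) = 0 := by
    intro c
    have : Φ ∘ₗ boundary ℤ X 1 = 0 := by
      ext σ
      simp only [LinearMap.comp_apply, Finsupp.lsingle_apply, LinearMap.zero_apply]
      rw [boundary_single, map_sum, Fin.sum_univ_three]
      simp only [map_smul, hΦ, deckCocycle_face hp σ, map_mul, ofMul_mul]
      simp
    exact LinearMap.congr_fun this c
  let Ψ : H1 X →ₗ[ℤ] Additive (Abelianization G) :=
    Submodule.liftQ _ (Φ ∘ₗ (LinearMap.ker (boundary ℤ X 0)).subtype) (by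
      rintro ⟨c, hc⟩ ⟨d, hd⟩
      change Φ c = 0
      have hd' : boundary ℤ X 1 d = c := hd
      rw [← hd', hΦb])
  obtain ⟨σ, hσ, hσg⟩ := exists_loop_deckCocycle hp g
  have hcyc : Finsupp.single σ 1 ∈ LinearMap.ker (boundary ℤ X 0) := by
    rw [LinearMap.mem_ker, boundary_single, Fin.sum_univ_two, hσ]
    simp
  have h1 : Ψ (Submodule.Quotient.mk ⟨_, hcyc⟩) = Additive.ofMul (Abelianization.of g) := by
    change Φ (Finsupp.single σ 1) = _
    rw [hΦ, hσg]
  -- For infinite `H1 X` the cardinality is `0` by convention and the equation is trivial.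
  have h2 : Nat.card (H1 X) • (Submodule.Quotient.mk ⟨_, hcyc⟩ : H1 X) = 0 :=
    card_nsmul_eq_zero'
  have h3 := congrArg Ψ h2
  rw [map_nsmul, h1, map_zero] at h3
  have h4 : Abelianization.of (g ^ Nat.card (H1 X)) = 1 := by
    rw [map_pow]
    exact congrArg Additive.toMul h3
  exact (QuotientGroup.eq_one_iff _).1 h4

theorem betti1_eq_zero_iff : betti1 X = 0 ↔ ∀ z : Simp X 1 → ℚ, coboundary ℚ X 1 z = 0 →
    ∃ c : Simp X 0 → ℚ, coboundary ℚ X 0 c = z := by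
  rw [betti1, rank_zero_iff, Submodule.Quotient.subsingleton_iff]
  constructor
  · intro h z hz
    have : (⟨z, hz⟩ : LinearMap.ker (coboundary ℚ X 1)) ∈
        (LinearMap.range (coboundary ℚ X 0)).submoduleOf (LinearMap.ker (coboundary ℚ X 1)) := by
      rw [h]; trivial
    exact this
  · intro h
    rw [eq_top_iff]
    rintro ⟨z, hz⟩ _
    exact h z hz

theorem coboundary_zero_apply (c : Simp X 0 → ℚ) (σ : Simp X 1) :
    coboundary ℚ X 0 c σ = c (face 0 σ) - c (face 1 σ) := by
  simp [coboundary, sub_eq_add_neg]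

theorem coboundary_one_apply (c : Simp X 1 → ℚ) (σ : Simp X 2) :
    coboundary ℚ X 1 c σ = c (face 0 σ) - c (face 1 σ) + c (face 2 σ) := by
  simp [coboundary, sub_eq_add_neg, Fin.sum_univ_three]

/-- If the first Betti number vanishes, the group of a quotient covering has no rational
characters. -/
theorem character_eq_one_of_betti1 [PathConnectedSpace E] (hp : IsQuotientCoveringMap p G)
    (h : betti1 X = 0) (f : G →* Multiplicative ℚ) : f = 1 := by
  obtain ⟨c, hc⟩ := betti1_eq_zero_iff.1 h (fun σ => (f (deckCocycle hp σ)).toAdd) (by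
    ext σ
    rw [coboundary_one_apply, deckCocycle_face, map_mul, toAdd_mul]
    simp)
  ext g
  obtain ⟨σ, hσ, hσg⟩ := exists_loop_deckCocycle hp g
  have := congrFun hc σ
  rw [coboundary_zero_apply, hσ, sub_self, hσg] at this
  exact this.symm

/-- The cocycle condition determines a cocycle on a contractible covering from its values on the
paths of the contraction. -/
theorem cocycle_eq_sub {z : Simp X 1 → ℚ} (hz : coboundary ℚ X 1 z = 0) (C : C(unitInterval × E, E)) {e₀ : E}
    (hC0 : ∀ e, C (0, e) = e₀) (hC1 : ∀ e, C (1, e) = e) (q : C(E, X)) (σ : Simp E 1) :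
    z (q.comp σ) =
      z (q.comp (C.comp ⟨fun a => (stdSimplexHomeomorphUnitInterval a, σ (vtx 1)), by fun_prop⟩)) -
      z (q.comp (C.comp ⟨fun a => (stdSimplexHomeomorphUnitInterval a, σ (vtx 0)), by fun_prop⟩)) := by
  have hz' : ∀ τ : Simp X 2, z (face 0 τ) - z (face 1 τ) + z (face 2 τ) = 0 := fun τ => by
    rw [← coboundary_one_apply, hz]; rfl
  -- the square between the constant simplex and `σ`
  let Q : C(stdSimplex ℝ (Fin 2) × stdSimplex ℝ (Fin 2), X) :=
    q.comp (C.comp ⟨fun x => (stdSimplexHomeomorphUnitInterval x.1, σ x.2), by fun_prop⟩)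
  have hQ : ∀ a b, Q (a, b) = q (C (stdSimplexHomeomorphUnitInterval a, σ b)) := fun a b => rfl
  let tri (f g : Fin 3 → Fin 2) : Simp X 2 :=
    Q.comp ⟨fun x => (stdSimplex.map f x, stdSimplex.map g x),
      (stdSimplex.continuous_map f).prodMk (stdSimplex.continuous_map g)⟩
  have htri : ∀ f g i x, face i (tri f g) x =
      Q (stdSimplex.map (f ∘ i.succAbove) x, stdSimplex.map (g ∘ i.succAbove) x) := by
    intro f g i x
    change Q (stdSimplex.map f (stdSimplex.map i.succAbove x),
      stdSimplex.map g (stdSimplex.map i.succAbove x)) = _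
    rw [stdSimplex.map_comp_apply, stdSimplex.map_comp_apply]
  -- The two vertex maps cut the square into triangles along the diagonal, on which both coordinates
  -- are the identity. Adding the two cocycle relations cancels the diagonal.
  let fA : Fin 3 → Fin 2 := ![0, 0, 1]
  let fB : Fin 3 → Fin 2 := ![0, 1, 1]
  have a0 : fA ∘ (0 : Fin 3).succAbove = id := by ext i; fin_cases i <;> rfl
  have a1 : fA ∘ (1 : Fin 3).succAbove = id := by ext i; fin_cases i <;> rfl
  have a2 : fA ∘ (2 : Fin 3).succAbove = fun _ => 0 := by ext i; fin_cases i <;> rfl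
  have b0 : fB ∘ (0 : Fin 3).succAbove = fun _ => 1 := by ext i; fin_cases i <;> rfl
  have b1 : fB ∘ (1 : Fin 3).succAbove = id := by ext i; fin_cases i <;> rfl
  have b2 : fB ∘ (2 : Fin 3).succAbove = id := by ext i; fin_cases i <;> rfl
  have hu0 : stdSimplexHomeomorphUnitInterval (vtx 0) = 0 := rfl
  have hu1 : stdSimplexHomeomorphUnitInterval (vtx 1) = 1 := rfl
  have A0 : face 0 (tri fB fA) = q.comp σ := by
    ext x
    rw [htri, a0, b0, stdSimplex_map_const, stdSimplex.map_id_apply, hQ, hu1, hC1]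
    rfl
  have A2 : face 2 (tri fB fA) =
      q.comp (C.comp ⟨fun a => (stdSimplexHomeomorphUnitInterval a, σ (vtx 0)), by fun_prop⟩) := by
    ext x
    rw [htri, a2, b2, stdSimplex_map_const, stdSimplex.map_id_apply, hQ]
    rfl
  have B0 : face 0 (tri fA fB) =
      q.comp (C.comp ⟨fun a => (stdSimplexHomeomorphUnitInterval a, σ (vtx 1)), by fun_prop⟩) := by
    ext x
    rw [htri, a0, b0, stdSimplex_map_const, stdSimplex.map_id_apply, hQ]
    rfl
  have B2 : face 2 (tri fA fB) = ContinuousMap.const _ (q e₀) := by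
    ext x
    rw [htri, a2, b2, stdSimplex_map_const, stdSimplex.map_id_apply, hQ, hu0, hC0]
    rfl
  have AB : face 1 (tri fA fB) = face 1 (tri fB fA) := by
    ext x
    rw [htri, htri, a1, b1]
  have hconst : z (ContinuousMap.const _ (q e₀)) = 0 := by
    have : ∀ i, face i (ContinuousMap.const _ (q e₀) : Simp X 2) = ContinuousMap.const _ (q e₀) :=
      fun i => rfl
    have h := hz' (ContinuousMap.const _ (q e₀))
    rw [this, this, this] at h
    simpa using h
  have h1 := hz' (tri fB fA)
  have h2 := hz' (tri fA fB)
  rw [A0, A2] at h1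
  rw [B0, B2, AB, hconst] at h2
  linarith

/-- The first Betti number of the quotient of a contractible space by a group without rational
characters vanishes. -/
theorem betti1_eq_zero_of_character (hp : IsQuotientCoveringMap p G) (C : C(unitInterval × E, E)) {e₀ : E}
    (hC0 : ∀ e, C (0, e) = e₀) (hC1 : ∀ e, C (1, e) = e)
    (hG : ∀ f : G →* Multiplicative ℚ, f = 1) : betti1 X = 0 := by
  have := hp.toContinuousConstSMul
  rw [betti1_eq_zero_iff]
  intro z hz
  let q : C(E, X) := ⟨p, hp.continuous⟩
  let H : E → ℚ := fun e =>
    z (q.comp (C.comp ⟨fun a => (stdSimplexHomeomorphUnitInterval a, e), by fun_prop⟩))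
  have hH : ∀ σ : Simp E 1, z (q.comp σ) = H (σ (vtx 1)) - H (σ (vtx 0)) :=
    fun σ => cocycle_eq_sub hz C hC0 hC1 q σ
  -- The path from `e₀` to `e` and its translate by `g` have the same projection. Hence the change
  -- of the primitive `H` under `g` is independent of the point and defines a character.
  have hdiff : ∀ (g : G) (e : E), H (g • e) - H e = H (g • e₀) - H e₀ := by
    intro g e
    let σ : Simp E 1 := C.comp ⟨fun a => (stdSimplexHomeomorphUnitInterval a, e), by fun_prop⟩
    let σ' : Simp E 1 := (⟨fun x => g • x, continuous_const_smul g⟩ : C(E, E)).comp σ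
    have h0 : σ (vtx 0) = e₀ := hC0 e
    have h1 : σ (vtx 1) = e := hC1 e
    have hσ : q.comp σ' = q.comp σ := by
      ext a
      exact hp.map_smul g
    have h2 := hH σ
    have h3 := hH σ'
    have h4 : σ' (vtx 0) = g • e₀ := congrArg (g • ·) h0
    have h5 : σ' (vtx 1) = g • e := congrArg (g • ·) h1
    rw [hσ, h4, h5] at h3
    rw [h0, h1] at h2
    linarith
  let f : G →* Multiplicative ℚ :=
    { toFun := fun g => Multiplicative.ofAdd (H (g • e₀) - H e₀)
      map_one' := by simp
      map_mul' := fun g h => by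
        rw [← ofAdd_add, ← hdiff g (h • e₀), mul_smul]
        congr 1
        ring }
  have hinv : ∀ (g : G) (e : E), H (g • e) = H e := by
    intro g e
    have h1 : H (g • e₀) - H e₀ = 0 :=
      congrArg Multiplicative.toAdd (DFunLike.congr_fun (hG f) g)
    have h2 := hdiff g e
    linarith
  have hfib : ∀ e e', p e = p e' → H e = H e' := by
    intro e e' h
    obtain ⟨g, hg⟩ := hp.apply_eq_iff_mem_orbit.1 h
    rw [← hg]
    exact hinv g e'
  -- With trivial character, `H` is constant on fibres and descends to a primitive of `z` on the
  -- base.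
  refine ⟨fun σ => H (coverSection hp (σ (vtx 0))), ?_⟩
  ext σ
  obtain ⟨τ, hτ⟩ := exists_lift_simp hp σ
  have hσ : σ = q.comp τ := by
    ext a
    exact (hτ a).symm
  rw [coboundary_zero_apply, face_vtx, face_vtx, hσ, hH]
  congr 1
  · exact hfib _ _ (apply_coverSection hp _)
  · exact hfib _ _ (apply_coverSection hp _)

end Covering
end HypMfd
end


noncomputable section

namespace HypMfd

open scoped MatrixGroups ComplexOrder NNReal ENNReal
open Matrix Topology

/-! ### The geometry of hyperbolic 3-space -/

/-- The trace of a point of `ℍ³`, that is, twice the hyperbolic cosine of its distance from the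
identity matrix. -/
def trH (P : H3) : ℝ := (Matrix.trace P.1).re

theorem continuous_val_H3 : Continuous fun P : H3 => P.1 := continuous_subtype_val

theorem continuous_trH : Continuous trH :=
  Complex.continuous_re.comp continuous_val_H3.matrix_trace

theorem trace_eq_trH (P : H3) : Matrix.trace P.1 = (trH P : ℂ) := by
  have h : star (Matrix.trace P.1) = Matrix.trace P.1 := by
    rw [← Matrix.trace_conjTranspose, P.2.1.isHermitian.eq]
  exact (Complex.conj_eq_iff_re.1 h).symm

theorem trH_pos (P : H3) : 0 < trH P := by
  have h := P.2.1.trace_pos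
  rw [trace_eq_trH] at h
  exact_mod_cast h

theorem mul_self_eq_H3 (P : H3) : P.1 * P.1 = (trH P : ℂ) • P.1 - 1 := by
  have h := sq_eq_trace_smul_sub_det P.1
  rwa [sq, P.2.2, one_smul, trace_eq_trH] at h

/-- Cayley-Hamilton gives `tr P • P = 1 + P * Pᴴ`, which is positive definite. This describes `H3`
by closed conditions, whence it is closed in the matrices and locally compact. -/
theorem posDef_of_trace_pos {P : Matrix (Fin 2) (Fin 2) ℂ} (hP : P.IsHermitian) (hdet : P.det = 1)
    (htr : 0 ≤ P.trace.re) : P.PosDef := by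
  have hreal : P.trace = (P.trace.re : ℂ) := by
    have h : star (Matrix.trace P) = Matrix.trace P := by
      rw [← Matrix.trace_conjTranspose, hP.eq]
    exact (Complex.conj_eq_iff_re.1 h).symm
  have hsq := sq_eq_trace_smul_sub_det P
  rw [hdet, one_smul, sq] at hsq
  have hpd : (P.trace • P).PosDef := by
    have h1 : P.trace • P = 1 + P * Pᴴ := by rw [hP.eq, hsq]; abel
    rw [h1]
    exact Matrix.PosDef.one.add_posSemidef (Matrix.posSemidef_self_mul_conjTranspose P)
  have h0 : P.trace.re ≠ 0 := by
    intro h0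
    rw [hreal, h0] at hpd
    have := hpd.det_pos
    simp at this
  have hpos : 0 < P.trace.re := lt_of_le_of_ne htr (Ne.symm h0)
  have h2 : P = ((P.trace.re)⁻¹ : ℝ) • (P.trace • P) := by
    rw [← Complex.coe_smul, smul_smul, Complex.ofReal_inv, ← hreal,
      inv_mul_cancel₀ (by rw [hreal]; exact_mod_cast h0), one_smul]
  rw [h2]
  exact hpd.smul (inv_pos.2 hpos)

theorem range_val_H3 : Set.range (fun P : H3 => P.1) =
    {P : Matrix (Fin 2) (Fin 2) ℂ | Pᴴ = P ∧ P.det = 1 ∧ 0 ≤ P.trace.re} := by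
  ext P
  constructor
  · rintro ⟨Q, rfl⟩
    exact ⟨Q.2.1.isHermitian.eq, Q.2.2, (trH_pos Q).le⟩
  · rintro ⟨h1, h2, h3⟩
    exact ⟨⟨P, posDef_of_trace_pos h1 h2 h3, h2⟩, rfl⟩

theorem isClosedEmbedding_val_H3 : IsClosedEmbedding (fun P : H3 => P.1) := by
  refine ⟨IsEmbedding.subtypeVal, ?_⟩
  rw [range_val_H3]
  exact (isClosed_eq continuous_id.matrix_conjTranspose continuous_id).inter
    ((isClosed_eq continuous_id.matrix_det continuous_const).inter
    (isClosed_le continuous_const (Complex.continuous_re.comp continuous_id.matrix_trace)))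

instance : T2Space H3 := isClosedEmbedding_val_H3.isEmbedding.t2Space

instance : LocallyCompactSpace H3 :=
  haveI : LocallyCompactSpace (Matrix (Fin 2) (Fin 2) ℂ) :=
    inferInstanceAs (LocallyCompactSpace (Fin 2 → Fin 2 → ℂ))
  isClosedEmbedding_val_H3.locallyCompactSpace

theorem trH_smul (g : SL2C) (P : H3) : trH (g • P) = (Matrix.trace (g.1 * P.1 * g.1ᴴ)).re := rfl

/-- Replace `tr P • P` by `P * P + 1` inside `g * P * gᴴ`. The bound controls the size of `g`
whenever it moves some point of bounded trace to another. -/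
theorem trace_self_mul_conjTranspose_le (g : SL2C) (P : H3) :
    (Matrix.trace (g.1 * g.1ᴴ)).re ≤ trH P * trH (g • P) := by
  have h : (trH P : ℂ) • (g.1 * P.1 * g.1ᴴ) = (g.1 * P.1) * (g.1 * P.1)ᴴ + g.1 * g.1ᴴ := by
    have h1 : (trH P : ℂ) • P.1 = P.1 * P.1 + 1 := by rw [mul_self_eq_H3]; abel
    rw [← smul_mul_assoc, ← mul_smul_comm, h1, conjTranspose_mul, P.2.1.isHermitian.eq]
    noncomm_ring
  have h2 := congrArg (fun m => (Matrix.trace m).re) h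
  simp only [Matrix.trace_smul, Matrix.trace_add, smul_eq_mul, Complex.re_ofReal_mul,
    Complex.add_re] at h2
  rw [trH_smul, h2]
  have := (Complex.nonneg_iff.1
    (Matrix.posSemidef_self_mul_conjTranspose (g.1 * P.1)).trace_nonneg).1
  linarith

theorem isUnit_det_H3 (x : H3) : IsUnit x.1.det := by rw [x.2.2]; exact isUnit_one

/-- From `tr x • x⁻¹ = x⁻¹ * x⁻¹ + 1`; the discarded term is the trace of the positive matrix `x⁻¹ *
y * x⁻¹`. -/
theorem trH_le_mul (x y : H3) : trH y ≤ trH x * (Matrix.trace (x.1⁻¹ * y.1)).re := by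
  have hu := isUnit_det_H3 x
  have h1 : (trH x : ℂ) • x.1⁻¹ = x.1⁻¹ * x.1⁻¹ + 1 := by
    have h := congrArg (fun m => x.1⁻¹ * (x.1⁻¹ * m)) (mul_self_eq_H3 x)
    simp only [mul_sub, mul_smul_comm, nonsing_inv_mul_cancel_left _ _ hu,
      nonsing_inv_mul _ hu, mul_one] at h
    rw [h]; abel
  have h2 : (trH x : ℂ) • (x.1⁻¹ * y.1) = x.1⁻¹ * (x.1⁻¹ * y.1) + y.1 := by
    rw [← smul_mul_assoc, h1]; noncomm_ring
  have h3 := congrArg (fun m => (Matrix.trace m).re) h2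
  simp only [Matrix.trace_smul, Matrix.trace_add, smul_eq_mul, Complex.re_ofReal_mul,
    Complex.add_re] at h3
  rw [h3]
  have h4 : (x.1⁻¹)ᴴ = x.1⁻¹ := x.2.1.isHermitian.inv.eq
  have h5 := (y.2.1.posSemidef.mul_mul_conjTranspose_same x.1⁻¹).trace_nonneg
  rw [h4, Matrix.trace_mul_comm] at h5
  have := (Complex.nonneg_iff.1 h5).1
  change (trace y.1).re ≤ _
  linarith

theorem trH_le_of_hdist_lt {x y : H3} {r : ℝ} (h : hdist x y < r) :
    trH y ≤ trH x * (2 * Real.cosh r) := by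
  refine (trH_le_mul x y).trans (mul_le_mul_of_nonneg_left ?_ (trH_pos x).le)
  suffices (trace (x.1⁻¹ * y.1)).re / 2 ≤ Real.cosh r by linarith
  rcases le_total 1 ((trace (x.1⁻¹ * y.1)).re / 2) with h1 | h1
  · rw [← Real.cosh_arcosh h1]
    refine Real.cosh_le_cosh.2 ?_
    rw [abs_of_nonneg (Real.arcosh_nonneg h1)]
    exact h.le.trans (le_abs_self r)
  · exact h1.trans (Real.one_le_cosh r)

theorem hdist_smul_smul (g : SL2C) (x y : H3) : hdist (g • x) (g • y) = hdist x y := by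
  have hg : IsUnit g.1.det := by rw [g.2]; exact isUnit_one
  have hg' : IsUnit (g.1ᴴ).det := by rw [det_conjTranspose, g.2]; simp
  have : (g • x).1⁻¹ * (g • y).1 = (g.1ᴴ)⁻¹ * ((x.1⁻¹ * y.1) * g.1ᴴ) := by
    change (g.1 * x.1 * g.1ᴴ)⁻¹ * (g.1 * y.1 * g.1ᴴ) = _
    rw [Matrix.mul_inv_rev, Matrix.mul_inv_rev]
    simp only [Matrix.mul_assoc]
    rw [nonsing_inv_mul_cancel_left _ _ hg]
  unfold hdist
  rw [this, Matrix.trace_mul_comm, Matrix.mul_assoc, Matrix.mul_nonsing_inv _ hg', Matrix.mul_one]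

theorem hdist_smul_smul_PSL (γ : PSL2C) (x y : H3) : hdist (γ • x) (γ • y) = hdist x y := by
  obtain ⟨g, rfl⟩ := QuotientGroup.mk_surjective γ
  exact hdist_smul_smul g x y

theorem continuous_smul_SL (g : SL2C) : Continuous fun P : H3 => g • P :=
  Continuous.subtype_mk (p := fun P : Matrix (Fin 2) (Fin 2) ℂ => P.PosDef ∧ P.det = 1)
    ((continuous_const.matrix_mul continuous_val_H3).matrix_mul continuous_const) _

instance : ContinuousConstSMul PSL2C H3 := ⟨fun γ => by
  obtain ⟨g, rfl⟩ := QuotientGroup.mk_surjective γ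
  exact continuous_smul_SL g⟩

instance (Γ : Subgroup PSL2C) : ContinuousConstSMul Γ H3 :=
  ⟨fun γ => continuous_const_smul γ.1⟩

/-- The trace of `g * gᴴ` is the sum of the squared absolute values of the entries, and `SL2C` is
closed in the matrices. -/
theorem isCompact_setOf_trace_le (C : ℝ) :
    IsCompact {g : SL2C | (Matrix.trace (g.1 * g.1ᴴ)).re ≤ C} := by
  have hK : IsCompact {m : Matrix (Fin 2) (Fin 2) ℂ | (Matrix.trace (m * mᴴ)).re ≤ C} := by
    have hcl : IsClosed {m : Matrix (Fin 2) (Fin 2) ℂ | (Matrix.trace (m * mᴴ)).re ≤ C} :=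
      isClosed_le (by fun_prop) continuous_const
    -- Radius `C + 1` avoids a square root: an entry with squared norm at most `C` has norm at most
    -- `C + 1`.
    have hcpt : IsCompact (Metric.closedBall (0 : Fin 2 → Fin 2 → ℂ) (C + 1)) :=
      isCompact_closedBall _ _
    refine IsCompact.of_isClosed_subset (X := Matrix (Fin 2) (Fin 2) ℂ) hcpt hcl ?_
    intro m hm
    have hm' : (Matrix.trace (m * mᴴ)).re ≤ C := hm
    simp only [Matrix.trace, Matrix.diag, Matrix.mul_apply, Fin.sum_univ_two,
      conjTranspose_apply, Complex.star_def, Complex.mul_conj, Complex.add_re,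
      Complex.ofReal_re] at hm'
    have hC : 0 ≤ C := by
      linarith [Complex.normSq_nonneg (m 0 0), Complex.normSq_nonneg (m 0 1),
        Complex.normSq_nonneg (m 1 0), Complex.normSq_nonneg (m 1 1)]
    refine (mem_closedBall_zero_iff (E := Fin 2 → Fin 2 → ℂ)).2 ?_
    refine (pi_norm_le_iff_of_nonneg (by linarith)).2 fun i =>
      (pi_norm_le_iff_of_nonneg (by linarith)).2 fun j => ?_
    have h1 : Complex.normSq (m i j) ≤ C := by
      have h00 := Complex.normSq_nonneg (m 0 0)
      have h01 := Complex.normSq_nonneg (m 0 1)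
      have h10 := Complex.normSq_nonneg (m 1 0)
      have h11 := Complex.normSq_nonneg (m 1 1)
      fin_cases i <;> fin_cases j <;> simp <;> linarith
    rw [Complex.normSq_eq_norm_sq] at h1
    change ‖m i j‖ ≤ _
    nlinarith [norm_nonneg (m i j)]
  exact Matrix.SpecialLinearGroup.isClosedEmbedding_val.isCompact_preimage hK

instance : T2Space PSL2C := by
  have : IsClosed ((Subgroup.center SL2C : Subgroup SL2C) : Set SL2C) := by
    rw [Subgroup.coe_center]
    have : Set.center SL2C = ⋂ h : SL2C, {g | g * h = h * g} := by
      ext g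
      simp [Semigroup.mem_center_iff, eq_comm]
    rw [this]
    exact isClosed_iInter fun h => isClosed_eq (by fun_prop) (by fun_prop)
  unfold PSL2C ProjectiveSpecialLinearGroup
  infer_instance

/-- Only finitely many elements of a discrete group move some point of bounded trace to a point of
bounded trace. -/
theorem finite_setOf_trH_le (Γ : Subgroup PSL2C) [DiscreteTopology Γ] (B : ℝ) :
    {γ : Γ | ∃ P : H3, trH P ≤ B ∧ trH (γ • P) ≤ B}.Finite := by
  have hcl : IsClosed (Γ : Set PSL2C) := Subgroup.isClosed_of_discrete
  have hK : IsCompact (QuotientGroup.mk (s := Subgroup.center SL2C) ''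
      {g : SL2C | (Matrix.trace (g.1 * g.1ᴴ)).re ≤ B * B}) :=
    (isCompact_setOf_trace_le _).image continuous_quot_mk
  have hK' : IsCompact ((↑) ⁻¹' (QuotientGroup.mk (s := Subgroup.center SL2C) ''
      {g : SL2C | (Matrix.trace (g.1 * g.1ᴴ)).re ≤ B * B}) : Set Γ) :=
    hcl.isClosedEmbedding_subtypeVal.isCompact_preimage hK
  refine hK'.finite_of_discrete.subset ?_
  rintro ⟨γ, hγ⟩ ⟨P, h1, h2⟩
  obtain ⟨g, rfl⟩ := QuotientGroup.mk_surjective γ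
  refine ⟨g, ?_, rfl⟩
  refine (trace_self_mul_conjTranspose_le g P).trans ?_
  exact mul_le_mul h1 h2 (trH_pos _).le ((trH_pos P).le.trans h1)

instance properlyDiscontinuousSMul_H3 (Γ : Subgroup PSL2C) [DiscreteTopology Γ] :
    ProperlyDiscontinuousSMul Γ H3 where
  finite_disjoint_inter_image {K L} hK hL := by
    obtain ⟨B, hB⟩ := ((hK.union hL).image continuous_trH).bddAbove
    refine (finite_setOf_trH_le Γ B).subset ?_
    intro γ hγ
    obtain ⟨_, ⟨P, hP, rfl⟩, hL'⟩ := hγ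
    exact ⟨P, hB ⟨P, Or.inl hP, rfl⟩, hB ⟨_, Or.inr hL', rfl⟩⟩

/-- All powers of an element of a point stabilizer lie in a finite set, so it has finite order. -/
theorem eq_one_of_smul_eq {Γ : Subgroup PSL2C} [DiscreteTopology Γ]
    (htf : ∀ g ∈ Γ, IsOfFinOrder g → g = 1) {γ : Γ} {P : H3} (h : γ • P = P) : γ = 1 := by
  have hfin : (Set.range fun n : ℕ => γ ^ n).Finite := by
    refine (finite_setOf_trH_le Γ (trH P)).subset ?_
    rintro _ ⟨n, rfl⟩
    have hn : γ ^ n • P = P := by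
      induction n with
      | zero => simp
      | succ n ih => rw [pow_succ, mul_smul, h, ih]
    exact ⟨P, le_rfl, by rw [hn]⟩
  have hfo : IsOfFinOrder γ := by
    by_contra hc
    exact Set.infinite_range_of_injective
      (injective_pow_iff_not_isOfFinOrder.2 hc) hfin
  exact Subtype.ext (htf γ.1 γ.2 ((Submonoid.isOfFinOrder_coe (H := Γ.toSubmonoid)).2 hfo))

theorem isCancelSMul_H3 {Γ : Subgroup PSL2C} [DiscreteTopology Γ]
    (htf : ∀ g ∈ Γ, IsOfFinOrder g → g = 1) : IsCancelSMul Γ H3 where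
  right_cancel' γ δ P h := by
    have : (δ⁻¹ * γ) • P = P := by rw [mul_smul, h, inv_smul_smul]
    exact (inv_mul_eq_one.1 (eq_one_of_smul_eq htf this)).symm

theorem isQuotientCoveringMap_Mfd {Γ : Subgroup PSL2C} [DiscreteTopology Γ]
    (htf : ∀ g ∈ Γ, IsOfFinOrder g → g = 1) :
    IsQuotientCoveringMap (fun x : H3 => (Quotient.mk'' x : Mfd Γ)) Γ :=
  haveI := isCancelSMul_H3 htf
  isQuotientCoveringMap_quotientMk_of_properlyDiscontinuousSMul

end HypMfd

end


/-! ### Contractibility of hyperbolic space, finite generation of the lattice, injectivity radius -/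

noncomputable section

namespace HypMfd

open scoped MatrixGroups ComplexOrder NNReal ENNReal
open Matrix Topology

/-- The determinant of the segment from the identity matrix to a point of `ℍ³`. -/
def segmentDet (t : ℝ) (P : H3) : ℝ := (1 - t) ^ 2 + t * (1 - t) * trH P + t ^ 2

theorem segmentDet_pos {t : ℝ} (h0 : 0 ≤ t) (h1 : t ≤ 1) (P : H3) : 0 < segmentDet t P := by
  have h2 : 0 ≤ t * (1 - t) * trH P :=
    mul_nonneg (mul_nonneg h0 (by linarith)) (trH_pos P).le
  unfold segmentDet
  nlinarith [sq_nonneg (1 - t - t)]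

/-- The segment from the identity matrix to a point of `ℍ³`, rescaled to determinant one. -/
def segmentMatrix (t : ℝ) (P : H3) : Matrix (Fin 2) (Fin 2) ℂ :=
  (√(segmentDet t P))⁻¹ • ((1 - t) • (1 : Matrix (Fin 2) (Fin 2) ℂ) + t • P.1)

theorem posDef_segmentMatrix {t : ℝ} (h0 : 0 ≤ t) (h1 : t ≤ 1) (P : H3) :
    (segmentMatrix t P).PosDef ∧ (segmentMatrix t P).det = 1 := by
  have hd := segmentDet_pos h0 h1 P
  have hdet : (segmentMatrix t P).det = 1 := by
    have h2 : P.1 0 0 + P.1 1 1 = trH P := by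
      rw [← trace_eq_trH, Matrix.trace_fin_two]
    have h3 : P.1 0 0 * P.1 1 1 - P.1 0 1 * P.1 1 0 = 1 := by
      rw [← Matrix.det_fin_two, P.2.2]
    have h4 : ((1 - t) • (1 : Matrix (Fin 2) (Fin 2) ℂ) + t • P.1).det = segmentDet t P := by
      rw [Matrix.det_fin_two]
      simp [segmentDet]
      linear_combination (t * (1 - t) : ℂ) * h2 + (t ^ 2 : ℂ) * h3
    have h5 : ((√(segmentDet t P) : ℝ) : ℂ) ^ 2 = segmentDet t P := by
      rw [← Complex.ofReal_pow, Real.sq_sqrt hd.le]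
    have h6 : ((segmentDet t P : ℝ) : ℂ) ≠ 0 := by exact_mod_cast hd.ne'
    rw [segmentMatrix, ← Complex.coe_smul, Matrix.det_smul, h4, Fintype.card_fin,
      Complex.ofReal_inv, inv_pow, h5, inv_mul_cancel₀ h6]
  refine ⟨posDef_of_trace_pos ?_ hdet ?_, hdet⟩
  · unfold Matrix.IsHermitian segmentMatrix
    simp [Matrix.conjTranspose_smul, P.2.1.isHermitian.eq]
  · have h2 : (segmentMatrix t P).trace.re =
        (√(segmentDet t P))⁻¹ * ((1 - t) * 2 + t * trH P) := by
      simp [segmentMatrix, trace_eq_trH, mul_add]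
    rw [h2]
    have := trH_pos P
    have h3 : 0 ≤ 1 - t := by linarith
    positivity

/-- `ℍ³` is contractible along the rescaled segments. -/
def contraction : C(unitInterval × H3, H3) where
  toFun x := ⟨segmentMatrix x.1 x.2, posDef_segmentMatrix x.1.2.1 x.1.2.2 x.2⟩
  continuous_toFun := by
    refine Continuous.subtype_mk
      (p := fun P : Matrix (Fin 2) (Fin 2) ℂ => P.PosDef ∧ P.det = 1) ?_ _
    have ht : Continuous fun x : unitInterval × H3 => (x.1 : ℝ) :=
      continuous_subtype_val.comp continuous_fst
    have htr : Continuous fun x : unitInterval × H3 => trH x.2 :=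
      continuous_trH.comp continuous_snd
    have hval : Continuous fun x : unitInterval × H3 => x.2.1 :=
      continuous_val_H3.comp continuous_snd
    have hd : Continuous fun x : unitInterval × H3 => segmentDet x.1 x.2 := by
      unfold segmentDet
      fun_prop
    have hs : Continuous fun x : unitInterval × H3 => (√(segmentDet x.1 x.2))⁻¹ :=
      (Real.continuous_sqrt.comp hd).inv₀ fun x =>
        (Real.sqrt_pos.2 (segmentDet_pos x.1.2.1 x.1.2.2 x.2)).ne'
    exact hs.smul (((continuous_const.sub ht).smul continuous_const).add (ht.smul hval))

/-- The identity matrix as a point of `ℍ³`. -/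
def origin : H3 := ⟨1, Matrix.PosDef.one, Matrix.det_one⟩

theorem contraction_zero (P : H3) : contraction (0, P) = origin :=
  Subtype.ext (show segmentMatrix (0 : ℝ) P = 1 by simp [segmentMatrix, segmentDet])

theorem contraction_one (P : H3) : contraction (1, P) = P :=
  Subtype.ext (show segmentMatrix (1 : ℝ) P = P.1 by simp [segmentMatrix, segmentDet])

instance : PathConnectedSpace H3 where
  nonempty := ⟨origin⟩
  joined x y := by
    have h : ∀ z, Joined origin z := fun z =>
      ⟨⟨contraction.comp ((ContinuousMap.id _).prodMk (.const _ z)), contraction_zero z,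
        contraction_one z⟩⟩
    exact (h x).symm.trans (h y)

/-- The images of the open sets `trH P < n` are increasing and cover the compact quotient, so one of
them is everything. -/
theorem exists_trH_smul_le {Γ : Subgroup PSL2C} (h : CompactSpace (Mfd Γ)) :
    ∃ R : ℝ, ∀ x : H3, ∃ γ : Γ, trH (γ • x) ≤ R := by
  let π : H3 → Mfd Γ := Quotient.mk''
  have hopen : IsOpenMap π := isOpenMap_quotient_mk'_mul
  obtain ⟨n, hn⟩ := isCompact_univ.elim_directed_cover (fun n : ℕ => π '' {P | trH P < n})
    (fun n => hopen _ (isOpen_lt continuous_trH continuous_const))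
    (fun q _ => by
      induction q using Quotient.inductionOn' with
      | h x =>
        obtain ⟨n, hn⟩ := exists_nat_gt (trH x)
        exact Set.mem_iUnion.2 ⟨n, x, hn, rfl⟩)
    (directed_of_isDirected_le fun m n hmn => Set.image_mono fun P (hP : trH P < m) =>
      hP.trans_le (by exact_mod_cast hmn))
  refine ⟨n, fun x => ?_⟩
  obtain ⟨y, hy, hyx⟩ := hn (Set.mem_univ (π x))
  obtain ⟨γ, hγ⟩ := MulAction.orbitRel_apply.1 (Quotient.exact' hyx)
  refine ⟨γ, ?_⟩
  rw [show γ • x = y from hγ]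
  exact le_of_lt hy

/-- The elements moving some point of a bounded region meeting all orbits back into it generate: the
translates belonging to the subgroup they generate and those belonging to its complement would
otherwise separate the connected space `H3`. -/
theorem fg_of_isClosedHyperbolic {Γ : Subgroup PSL2C} (hΓ : IsClosedHyperbolic Γ) : Group.FG Γ := by
  have := hΓ.discrete
  obtain ⟨R, hR⟩ := exists_trH_smul_le hΓ.compact
  let U : Set H3 := {P | trH P < R + 1}
  have hU : IsOpen U := isOpen_lt continuous_trH continuous_const
  let S : Set Γ := {γ | ∃ P : H3, trH P ≤ R + 1 ∧ trH (γ • P) ≤ R + 1}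
  have hS : S.Finite := finite_setOf_trH_le Γ (R + 1)
  let T (A : Set Γ) : Set H3 := ⋃ γ ∈ A, (fun P => γ • P) ⁻¹' U
  have hT : ∀ A, IsOpen (T A) := fun A =>
    isOpen_biUnion fun γ _ => hU.preimage (continuous_const_smul γ)
  obtain ⟨γ₀, hγ₀⟩ := hR origin
  have hu : γ₀ • origin ∈ U := lt_of_le_of_lt hγ₀ (lt_add_one R)
  let H := Subgroup.closure S
  have hcov : Set.univ ⊆ T H ∪ T (H : Set Γ)ᶜ := fun x _ => by
    obtain ⟨γ, hγ⟩ := hR x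
    have hx : γ • x ∈ U := lt_of_le_of_lt hγ (lt_add_one R)
    by_cases h : γ ∈ H
    · exact Or.inl (Set.mem_biUnion (show γ ∈ (H : Set Γ) from h) hx)
    · exact Or.inr (Set.mem_biUnion (show γ ∈ (H : Set Γ)ᶜ from h) hx)
  refine Group.fg_iff.2 ⟨S, ?_, hS⟩
  refine (Subgroup.eq_top_iff' _).2 fun γ => ?_
  by_contra hγ
  have h1 : (Set.univ ∩ T H).Nonempty :=
    ⟨γ₀ • origin, trivial, Set.mem_biUnion (show (1 : Γ) ∈ (H : Set Γ) from H.one_mem)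
      (by simpa using hu)⟩
  have h2 : (Set.univ ∩ T (H : Set Γ)ᶜ).Nonempty :=
    ⟨γ⁻¹ • γ₀ • origin, trivial, Set.mem_biUnion (show γ ∈ (H : Set Γ)ᶜ from hγ)
      (by simpa using hu)⟩
  obtain ⟨x, -, hx1, hx2⟩ := isPreconnected_univ (T H) (T (H : Set Γ)ᶜ) (hT _) (hT _) hcov h1 h2
  obtain ⟨a, ha, hax⟩ := Set.mem_iUnion₂.1 hx1
  obtain ⟨b, hb, hbx⟩ := Set.mem_iUnion₂.1 hx2
  have hba : b * a⁻¹ ∈ H := Subgroup.subset_closure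
    ⟨a • x, le_of_lt hax, by rw [mul_smul, inv_smul_smul]; exact le_of_lt hbx⟩
  exact hb (by simpa using H.mul_mem hba ha)

/-- Move the centre of the ball into a fixed bounded region by `Γ`; normality keeps the identifying
element in `Λ k`. Only finitely many elements of `Γ` can then identify two points of the ball, and
the nontrivial ones leave `Λ k` for large `k`. -/
theorem tendsto_injRad {Γ : Subgroup PSL2C} (hΓ : IsClosedHyperbolic Γ) {Λ : ℕ → Subgroup PSL2C}
    (hle : ∀ k, Λ k ≤ Γ) (hanti : Antitone Λ)
    (hconj : ∀ k, ∀ γ ∈ Γ, ∀ g ∈ Λ k, γ * g * γ⁻¹ ∈ Λ k)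
    (hbot : ∀ g, (∀ k, g ∈ Λ k) → g = 1) :
    Filter.Tendsto (fun k => injRad (Λ k)) Filter.atTop (nhds ⊤) := by
  have := hΓ.discrete
  obtain ⟨R, hR⟩ := exists_trH_smul_le hΓ.compact
  rw [ENNReal.tendsto_nhds_top_iff_nnreal]
  intro s
  let r : ℝ≥0 := s + 1
  have hF := finite_setOf_trH_le Γ (R * (2 * Real.cosh r))
  have hev : ∀ γ : Γ, ∀ᶠ k in Filter.atTop, γ.1 ∈ Λ k → γ = 1 := fun γ => by
    by_cases hγ : ∀ k, γ.1 ∈ Λ k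
    · exact Filter.Eventually.of_forall fun _ _ => Subtype.ext (hbot _ hγ)
    · obtain ⟨k, hk⟩ := not_forall.1 hγ
      filter_upwards [Filter.eventually_ge_atTop k] with l hl h
      exact absurd (hanti hl h) hk
  filter_upwards [(Filter.eventually_all_finite hF).2 fun γ _ => hev γ] with k hk
  refine lt_of_lt_of_le (b := (r : ℝ≥0∞)) (by exact_mod_cast lt_add_one s) ?_
  refine le_iSup₂_of_le r (fun x y hy z hz hyz => ?_) le_rfl
  obtain ⟨g, hg⟩ := MulAction.orbitRel_apply.1 (Quotient.exact' hyz)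
  obtain ⟨γ, hγ⟩ := hR x
  have hbound : ∀ w, hdist x w < r → trH (γ • w) ≤ R * (2 * Real.cosh r) := fun w hw => by
    rw [← hdist_smul_smul_PSL γ.1] at hw
    refine (trH_le_of_hdist_lt hw).trans (mul_le_mul_of_nonneg_right hγ ?_)
    have := Real.cosh_pos r
    positivity
  let g' : Γ := ⟨g.1, hle k g.2⟩
  have hgz : g' • z = y := hg
  have h1 : γ * g' * γ⁻¹ = 1 := by
    refine hk _ ⟨γ • z, hbound z hz, ?_⟩ (hconj k γ.1 γ.2 g.1 g.2)
    rw [mul_smul, mul_smul, inv_smul_smul, hgz]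
    exact hbound y hy
  have h2 : g' = 1 := conj_eq_one_iff.1 h1
  rw [← hgz, h2, one_smul]

end HypMfd

end


/-! ### Assembly of the main theorem -/

open HypMfd in
theorem mainTheorem6 (Γ : Subgroup PSL2C) (hΓ : IsClosedHyperbolic Γ)
    (p n : ℕ) (hp : p.Prime) (hram : RamifiesAtPrimeOfNorm Γ (p ^ n))
    (hβ : betti1 (Mfd Γ) = 0)
    (hH1 : Nat.Coprime (Nat.card (H1 (Mfd Γ))) (p ^ (2 * n) - 1))
    (x₀ : Mfd Γ) (hpow : IsPPowerful p (FundamentalGroup (Mfd Γ) x₀)) :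
    ExhaustedByRationalHomologySpheres Γ := by
  have := hΓ.discrete
  have hcov := isQuotientCoveringMap_Mfd hΓ.torsionFree
  have hFG : Group.FG Γ := fg_of_isClosedHyperbolic hΓ
  obtain ⟨Λ, h0, hanti, hnorm, hfin, hpgrp, hbot⟩ :=
    exists_congruence_tower ((Group.fg_iff_subgroup_fg Γ).1 hFG) hp hram hH1
      (pow_card_H1_mem_commutator hcov)
  -- Only surjectivity of the monodromy map onto `Γ` is needed, as powerfulness passes to quotients;
  -- it takes values in the opposite group, which inversion undoes.
  have hpowΓ : IsPPowerful p Γ := by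
    obtain ⟨e, he⟩ := hcov.surjective x₀
    let f := hcov.fundamentalGroupToMulOpposite (x := x₀) ⟨e, he⟩
    exact hpow.of_surjective ((MulEquiv.inv' Γ).symm.toMonoidHom.comp f)
      ((MulEquiv.inv' Γ).symm.surjective.comp
        (hcov.fundamentalGroupToMulOpposite_surjective _))
  have hchar : ∀ f : Γ →* Multiplicative ℚ, f = 1 := character_eq_one_of_betti1 hcov hβ
  have hle : ∀ k, (Λ k).map Γ.subtype ≤ Γ := fun k => Subgroup.map_subtype_le _
  refine ⟨fun k => (Λ k).map Γ.subtype, ?_, fun i j hij => Subgroup.map_mono (hanti hij), ?_, ?_, ?_⟩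
  · beta_reduce
    rw [h0, ← MonoidHom.range_eq_map, Subgroup.range_subtype]
  · intro k
    refine ⟨?_⟩
    rw [Subgroup.relIndex, Subgroup.subgroupOf, Subgroup.comap_map_eq_self_of_injective
      Γ.subtype_injective]
    exact (hfin k).index_ne_zero
  · intro k
    have hdisc : DiscreteTopology ((Λ k).map Γ.subtype) :=
      DiscreteTopology.of_subset (s := (Γ : Set PSL2C)) this (hle k)
    have htf : ∀ g ∈ (Λ k).map Γ.subtype, IsOfFinOrder g → g = 1 := fun g hg =>
      hΓ.torsionFree g (hle k hg)
    refine betti1_eq_zero_of_character (isQuotientCoveringMap_Mfd htf) contraction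
      contraction_zero contraction_one fun χ => ?_
    have := hnorm k
    have := hfin k
    let ε := (Λ k).equivMapOfInjective Γ.subtype Γ.subtype_injective
    have h1 := character_eq_one_of_powerful hp (Λ k) (fun q => by
      induction q using QuotientGroup.induction_on with
      | H g =>
        obtain ⟨e, he⟩ := hpgrp k g
        exact ⟨e, (QuotientGroup.eq_one_iff _).2 he⟩) hpowΓ hchar (χ.comp ε.toMonoidHom)
    ext x
    obtain ⟨y, rfl⟩ := ε.surjective x
    exact DFunLike.congr_fun h1 y
  · refine tendsto_injRad hΓ hle (fun i j hij => Subgroup.map_mono (hanti hij)) ?_ ?_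
    · rintro k γ hγ _ ⟨g, hg, rfl⟩
      exact ⟨⟨γ, hγ⟩ * g * ⟨γ, hγ⟩⁻¹, (hnorm k).conj_mem g hg _, rfl⟩
    · intro g hg
      obtain ⟨g', -, rfl⟩ := hg 0
      have : g' = 1 := hbot g' fun i => by
        obtain ⟨g'', h, h'⟩ := hg i
        rwa [Γ.subtype_injective h'] at h
      rw [this, map_one]
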